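/- Let $(\mathscr{C},\mathbb{E},\mathfrak{s})$ be an extriangulated category in the sense of Nakaoka and Palu, and let $\mathbb{E}^{n}$ ($n\ge 1$) denote its higher positive extensions in the sense of Gorsky, Nakaoka and Palu: $\mathbb{E}^1=\mathbb{E}$ and $\mathbb{E}^{n+1}(Z,A)=\int^{X\in\mathscr{C}}\mathbb{E}^{n}(X,A)\otimes_{\mathbb{Z}}\mathbb{E}(Z,X)$. For a full subcategory $\mathcal{X}\subseteq\mathscr{C}$, closed under isomorphisms, and $t\ge 0$ define $\mathcal{X}^{0}=\mathcal{X}_0=\mathcal{X}$; let $\mathcal{X}^{t+1}$ consist of the objects $X$ that admit an $\mathbb{E}$-triangle $X\to X_0\to K\dashrightarrow$ with $X_0\in\mathcal{X}$ and $K\in\mathcal{X}^{t}$, and let $\mathcal{X}_{t+1}$ consist of the objects $X$ that admit an $\mathbb{E}$-triangle $K\to Y_0\to X\dashrightarrow$ with $Y_0\in\mathcal{X}$ and $K\in\mathcal{X}_{t}$. Put $\mathcal{X}^{L}=\bigcup_{t\ge1}\mathcal{X}^{t}$ and $\mathcal{X}^{R}=\bigcup_{t\ge1}\mathcal{X}_{t}$.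 Let $\mathcal{T},\mathcal{F}$ be full subcategories of $\mathscr{C}$ closed under isomorphisms and direct summands, and assume that $(\mathcal{T},\mathcal{F})$ is a bounded hereditary cotorsion pair, that is: * (cotorsion pair) $\mathbb{E}(\mathcal{T},\mathcal{F})=0$, and for every $X\in\mathscr{C}$ there are $\mathbb{E}$-triangles $F_1\to T_1\to X\dashrightarrow$ and $X\to F_2\to T_2\dashrightarrow$ with $T_i\in\mathcal{T}$ and $F_i\in\mathcal{F}$; * (hereditary) $\mathbb{E}^{i}(\mathcal{T},\mathcal{F})=0$ for all $i\ge 2$; * (bounded) $\mathcal{T}^{R}=\mathcal{F}^{L}=\mathscr{C}$. For a full subcategory $\mathcal{X}$, the split Grothendieck group $K_0^{\rm sp}(\mathcal{X})$ is the free abelian group on the isomorphism classes $[X]$ of objects of $\mathcal{X}$ modulo the relations $[A\oplus B]-[A]-[B]$ for $A,B\in\mathcal{X}$ with $A\oplus B\in\mathcal{X}$, and $K_0(\mathcal{X})$ is the quotient of $K_0^{\rm sp}(\mathcal{X})$ by the relations $[A]-[B]+[Z]$ for all $\mathbb{E}$-triangles $A\to B\to Z\dashrightarrow$ with $A,B,Z\in\mathcal{X}$.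 Then there are isomorphisms of abelian groups $$K_{0}(\mathcal{T})\cong K_{0}(\mathcal{F})\cong K_{0}(\mathscr{C})\cong K_{0}^{\rm sp}(\mathcal{T}\cap\mathcal{F}),$$ and they can be chosen compatible with the inclusions into $\mathscr{C}$: the resulting isomorphisms $K_0(\mathcal{T})\to K_0(\mathscr{C})$, $K_0(\mathcal{F})\to K_0(\mathscr{C})$ and $K_0^{\rm sp}(\mathcal{T}\cap\mathcal{F})\to K_0(\mathscr{C})$ send $[X]$ to $[X]$. -/

import Mathlib

open CategoryTheory CategoryTheory.Limits Opposite

universe w v u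

namespace Extri

section Sequences

variable {C : Type u} [Category.{v} C]

/-- A sequence `A ⟶ B ⟶ Z` with fixed end terms `A` and `Z`. -/
structure Seq (A Z : C) where
  mid : C
  x : A ⟶ mid
  y : mid ⟶ Z

/-- Two sequences `A ⟶ B ⟶ Z` and `A ⟶ B' ⟶ Z` are equivalent if there is an isomorphism
`B ≅ B'` compatible with the morphisms from `A` and to `Z`. -/
instance seqSetoid (A Z : C) : Setoid (Seq A Z) where
  r S S' := ∃ b : S.mid ≅ S'.mid, S.x ≫ b.hom = S'.x ∧ b.hom ≫ S'.y = S.y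
  iseqv :=
    { refl := fun S => ⟨Iso.refl _, by simp, by simp⟩
      symm := by
        rintro S S' ⟨b, h₁, h₂⟩
        exact ⟨b.symm, by simp [← h₁], by simp [← h₂]⟩
      trans := by
        rintro S S' S'' ⟨b, h₁, h₂⟩ ⟨b', h₁', h₂'⟩
        exact ⟨b ≪≫ b', by simp [← h₁', ← h₁], by simp [← h₂, ← h₂']⟩ }

end Sequences

variable (C : Type u) [Category.{v} C]

/-- The data `(𝔼, 𝔰)` on an additive category: a bifunctor `𝔼 : Cᵒᵖ × C ⥤ Ab`, and a
correspondence `𝔰` sending each `δ ∈ 𝔼(Z, A)` to an equivalence class of sequences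
`A ⟶ B ⟶ Z`. -/
structure ExtData where
  E : Cᵒᵖ ⥤ C ⥤ AddCommGrpCat.{w}
  s : ∀ {A Z : C}, ((E.obj (op Z)).obj A) → Quotient (seqSetoid A Z)

namespace ExtData

variable {C} (P : ExtData.{w} C)

/-- The group `𝔼(Z, A)` of extensions. -/
abbrev Ext (Z A : C) : Type w := (P.E.obj (op Z)).obj A

/-- `a_* : 𝔼(Z, A) → 𝔼(Z, A')`. -/
def push {Z A A' : C} (a : A ⟶ A') : P.Ext Z A →+ P.Ext Z A' :=
  ((P.E.obj (op Z)).map a).hom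

/-- `c^* : 𝔼(Z, A) → 𝔼(Z', A)`. -/
def pull {Z Z' A : C} (c : Z' ⟶ Z) : P.Ext Z A →+ P.Ext Z' A :=
  ((P.E.map c.op).app A).hom

lemma push_pull {Z Z' A A' : C} (a : A ⟶ A') (c : Z' ⟶ Z) (δ : P.Ext Z A) :
    P.push a (P.pull c δ) = P.pull c (P.push a δ) := by
  have h := (P.E.map c.op).naturality a
  exact (ConcreteCategory.congr_hom h δ).symm

/-- `A --x--> B --y--> Z --δ-->` is an `𝔼`-triangle: `𝔰(δ) = [A --x--> B --y--> Z]`. -/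
def IsTriangle {A B Z : C} (x : A ⟶ B) (y : B ⟶ Z) (δ : P.Ext Z A) : Prop :=
  P.s δ = Quotient.mk (seqSetoid A Z) ⟨B, x, y⟩

/-- There is an `𝔼`-triangle `A ⟶ B ⟶ Z ⇢`. -/
def Conflation (A B Z : C) : Prop :=
  ∃ (x : A ⟶ B) (y : B ⟶ Z) (δ : P.Ext Z A), P.IsTriangle x y δ

variable [Preadditive C] [HasBinaryBiproducts C]

/-- The direct sum `δ ⊕ δ' ∈ 𝔼(Z ⊞ Z', A ⊞ A')` of two extensions: its components are
`δ`, `0`, `0`, `δ'`. -/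
noncomputable def directSum {A Z A' Z' : C} (δ : P.Ext Z A) (δ' : P.Ext Z' A') :
    P.Ext (Z ⊞ Z') (A ⊞ A') :=
  P.push biprod.inl (P.pull biprod.fst δ) + P.push biprod.inr (P.pull biprod.snd δ')

/-- The axioms of an extriangulated category in the sense of Nakaoka and Palu. -/
class IsExtriangulated : Prop where
  /-- (ET1) `𝔼` is additive in each variable. -/
  additive_right : ∀ Z : Cᵒᵖ, (P.E.obj Z).Additive
  additive_left : ∀ A : C, (P.E.flip.obj A).Additive
  /-- (ET2) `𝔰` is a realization: morphisms of extensions lift to morphisms of sequences. -/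
  realize : ∀ {A B Z A' B' Z' : C} {x : A ⟶ B} {y : B ⟶ Z} {δ : P.Ext Z A}
    {x' : A' ⟶ B'} {y' : B' ⟶ Z'} {δ' : P.Ext Z' A'},
    P.IsTriangle x y δ → P.IsTriangle x' y' δ' →
    ∀ (a : A ⟶ A') (c : Z ⟶ Z'), P.push a δ = P.pull c δ' →
      ∃ b : B ⟶ B', x ≫ b = a ≫ x' ∧ y ≫ c = b ≫ y'
  /-- (ET2) `𝔰` sends zero to the split sequence. -/
  realize_zero : ∀ A Z : C,
    P.IsTriangle (biprod.inl : A ⟶ A ⊞ Z) (biprod.snd : A ⊞ Z ⟶ Z) (0 : P.Ext Z A)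
  /-- (ET2) `𝔰` is compatible with direct sums. -/
  realize_sum : ∀ {A B Z A' B' Z' : C} {x : A ⟶ B} {y : B ⟶ Z} {δ : P.Ext Z A}
    {x' : A' ⟶ B'} {y' : B' ⟶ Z'} {δ' : P.Ext Z' A'},
    P.IsTriangle x y δ → P.IsTriangle x' y' δ' →
    P.IsTriangle (biprod.map x x') (biprod.map y y') (P.directSum δ δ')
  /-- (ET3) -/
  et3 : ∀ {A B Z A' B' Z' : C} {x : A ⟶ B} {y : B ⟶ Z} {δ : P.Ext Z A}
    {x' : A' ⟶ B'} {y' : B' ⟶ Z'} {δ' : P.Ext Z' A'},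
    P.IsTriangle x y δ → P.IsTriangle x' y' δ' →
    ∀ (a : A ⟶ A') (b : B ⟶ B'), x ≫ b = a ≫ x' →
      ∃ c : Z ⟶ Z', y ≫ c = b ≫ y' ∧ P.push a δ = P.pull c δ'
  /-- (ET3)ᵒᵖ -/
  et3_op : ∀ {A B Z A' B' Z' : C} {x : A ⟶ B} {y : B ⟶ Z} {δ : P.Ext Z A}
    {x' : A' ⟶ B'} {y' : B' ⟶ Z'} {δ' : P.Ext Z' A'},
    P.IsTriangle x y δ → P.IsTriangle x' y' δ' →
    ∀ (b : B ⟶ B') (c : Z ⟶ Z'), y ≫ c = b ≫ y' →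
      ∃ a : A ⟶ A', x ≫ b = a ≫ x' ∧ P.push a δ = P.pull c δ'
  /-- (ET4) -/
  et4 : ∀ {A B Z D F : C} {f : A ⟶ B} {f' : B ⟶ D} {δ : P.Ext D A}
    {g : B ⟶ Z} {g' : Z ⟶ F} {δ' : P.Ext F B},
    P.IsTriangle f f' δ → P.IsTriangle g g' δ' →
    ∃ (X : C) (h' : Z ⟶ X) (d : D ⟶ X) (e : X ⟶ F) (δ'' : P.Ext X A),
      P.IsTriangle (f ≫ g) h' δ'' ∧ g ≫ h' = f' ≫ d ∧ h' ≫ e = g' ∧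
      P.IsTriangle d e (P.push f' δ') ∧ P.pull d δ'' = δ ∧ P.push f δ'' = P.pull e δ'
  /-- (ET4)ᵒᵖ -/
  et4_op : ∀ {A B Z D F : C} {f' : D ⟶ A} {f : A ⟶ B} {δ : P.Ext B D}
    {g' : F ⟶ B} {g : B ⟶ Z} {δ' : P.Ext Z F},
    P.IsTriangle f' f δ → P.IsTriangle g' g δ' →
    ∃ (X : C) (h' : X ⟶ A) (d : D ⟶ X) (e : X ⟶ F) (δ'' : P.Ext Z X),
      P.IsTriangle h' (f ≫ g) δ'' ∧ h' ≫ f = e ≫ g' ∧ d ≫ h' = f' ∧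
      P.IsTriangle d e (P.pull g' δ) ∧ P.push e δ'' = δ' ∧ P.push d δ = P.pull g δ''

section HigherExtensions

/-- Generators `g ⊗ δ`, with `g ∈ G(X)` and `δ ∈ 𝔼(Z, X)`, of the coend
`∫^X G(X) ⊗ 𝔼(Z, X)`. -/
abbrev CoendGen (G : Cᵒᵖ ⥤ AddCommGrpCat.{max u v w}) (Z : C) : Type (max u v w) :=
  Σ X : C, G.obj (op X) × P.Ext Z X

/-- The relations of the coend `∫^X G(X) ⊗ 𝔼(Z, X)`: biadditivity, and
`f^* g ⊗ δ = g ⊗ f_* δ`. -/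
inductive CoendRel (G : Cᵒᵖ ⥤ AddCommGrpCat.{max u v w}) (Z : C) :
    FreeAbelianGroup (P.CoendGen G Z) → Prop
  | add_left {X : C} (g g' : G.obj (op X)) (δ : P.Ext Z X) :
      CoendRel G Z (.of ⟨X, g + g', δ⟩ - .of ⟨X, g, δ⟩ - .of ⟨X, g', δ⟩)
  | add_right {X : C} (g : G.obj (op X)) (δ δ' : P.Ext Z X) :
      CoendRel G Z (.of ⟨X, g, δ + δ'⟩ - .of ⟨X, g, δ⟩ - .of ⟨X, g, δ'⟩)
  | balance {X Y : C} (f : X ⟶ Y) (g : G.obj (op Y)) (δ : P.Ext Z X) :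
      CoendRel G Z (.of ⟨X, (G.map f.op).hom g, δ⟩ - .of ⟨Y, g, P.push f δ⟩)

/-- The coend `∫^X G(X) ⊗ 𝔼(Z, X)`, as an abelian group. -/
abbrev Coend (G : Cᵒᵖ ⥤ AddCommGrpCat.{max u v w}) (Z : C) : Type (max u v w) :=
  FreeAbelianGroup (P.CoendGen G Z) ⧸ AddSubgroup.closure {r | P.CoendRel G Z r}

/-- The map on coends induced by `c : Z' ⟶ Z`, given by `g ⊗ δ ↦ g ⊗ c^* δ`. -/
def coendMap (G : Cᵒᵖ ⥤ AddCommGrpCat.{max u v w}) {Z Z' : C} (c : Z' ⟶ Z) :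
    P.Coend G Z →+ P.Coend G Z' :=
  QuotientAddGroup.map _ _
    (FreeAbelianGroup.map fun t : P.CoendGen G Z => (⟨t.1, t.2.1, P.pull c t.2.2⟩ : P.CoendGen G Z'))
    (by
      rw [AddSubgroup.closure_le]
      rintro _ (⟨g, g', δ⟩ | ⟨g, δ, δ'⟩ | ⟨f, g, δ⟩) <;>
        apply AddSubgroup.subset_closure
      · simpa using CoendRel.add_left (P := P) g g' (P.pull c δ)
      · simpa using CoendRel.add_right (P := P) g (P.pull c δ) (P.pull c δ')
      · simpa [push_pull] using CoendRel.balance (P := P) f g (P.pull c δ))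

/-- The functor `Z ↦ ∫^X G(X) ⊗ 𝔼(Z, X)`. -/
def coendFunctor (G : Cᵒᵖ ⥤ AddCommGrpCat.{max u v w}) : Cᵒᵖ ⥤ AddCommGrpCat.{max u v w} where
  obj Z := AddCommGrpCat.of (P.Coend G Z.unop)
  map c := AddCommGrpCat.ofHom (P.coendMap G c.unop)
  map_id Z := by
    ext t
    simp [coendMap, pull]
  map_comp c c' := by
    ext t
    simp [coendMap, pull]

/-- The higher extension functors `𝔼ⁿ(-, A)`: `𝔼⁰ = Hom`, `𝔼¹ = 𝔼`, and
`𝔼ⁿ⁺¹(Z, A) = ∫^X 𝔼ⁿ(X, A) ⊗ 𝔼(Z, X)` for `n ≥ 1`. -/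
def higherExt (A : C) : ℕ → Cᵒᵖ ⥤ AddCommGrpCat.{max u v w}
  | 0 => preadditiveYoneda.obj A ⋙ AddCommGrpCat.uliftFunctor.{max u w}
  | 1 => P.E.flip.obj A ⋙ AddCommGrpCat.uliftFunctor.{max u v}
  | n + 2 => P.coendFunctor (higherExt A (n + 1))

/-- The abelian group `𝔼ⁿ(Z, A)`. -/
abbrev ExtN (n : ℕ) (Z A : C) : Type (max u v w) := (P.higherExt A n).obj (op Z)

end HigherExtensions

section Filtrations

/-- `leftFilt M t` is the class of the objects `X` with an `M^L`-filtration
`X ⟶ X₀ ⟶ ⋯ ⟶ X_t ⟶ 0` of length `t`: a chain of `𝔼`-triangles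
`X ⟶ X₀ ⟶ K₀ ⇢`, `K₀ ⟶ X₁ ⟶ K₁ ⇢`, …, `K_{t-2} ⟶ X_{t-1} ⟶ X_t ⇢` with all `X_i` in `M`. -/
def leftFilt (M : ObjectProperty C) : ℕ → ObjectProperty C
  | 0 => M
  | t + 1 => fun X => ∃ X₀ K : C, M X₀ ∧ leftFilt M t K ∧ P.Conflation X X₀ K

/-- `rightFilt M t` is the class of the objects `X` with an `M^R`-filtration
`0 ⟶ Y_t ⟶ ⋯ ⟶ Y₀ ⟶ X` of length `t`: a chain of `𝔼`-triangles
`K₀ ⟶ Y₀ ⟶ X ⇢`, `K₁ ⟶ Y₁ ⟶ K₀ ⇢`, …, `Y_t ⟶ Y_{t-1} ⟶ K_{t-2} ⇢` with all `Y_i` in `M`. -/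
def rightFilt (M : ObjectProperty C) : ℕ → ObjectProperty C
  | 0 => M
  | t + 1 => fun X => ∃ Y₀ K : C, M Y₀ ∧ rightFilt M t K ∧ P.Conflation K Y₀ X

/-- `M^L`, the union of the `M^t` over `t ≥ 1`. -/
def leftClosure (M : ObjectProperty C) : ObjectProperty C :=
  fun X => ∃ t : ℕ, 1 ≤ t ∧ P.leftFilt M t X

/-- `M^R`, the union of the `M_t` over `t ≥ 1`. -/
def rightClosure (M : ObjectProperty C) : ObjectProperty C :=
  fun X => ∃ t : ℕ, 1 ≤ t ∧ P.rightFilt M t X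

end Filtrations

end ExtData

variable {C}
variable [Preadditive C] [HasBinaryBiproducts C]

/-- Closure under direct summands (in particular, under isomorphisms). -/
def ClosedUnderSummands (T : ObjectProperty C) : Prop :=
  ∀ X Y Z : C, T Z → Nonempty (Z ≅ X ⊞ Y) → T X

namespace ExtData

variable (P : ExtData.{w} C)

/-- `(T, F)` is a cotorsion pair. -/
structure IsCotorsionPair (T F : ObjectProperty C) : Prop where
  summands_left : ClosedUnderSummands T
  summands_right : ClosedUnderSummands F
  ext_eq_zero : ∀ X Y : C, T X → F Y → ∀ δ : P.Ext X Y, δ = 0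
  exists_left : ∀ X : C, ∃ F₁ T₁ : C, F F₁ ∧ T T₁ ∧ P.Conflation F₁ T₁ X
  exists_right : ∀ X : C, ∃ F₂ T₂ : C, F F₂ ∧ T T₂ ∧ P.Conflation X F₂ T₂

/-- `𝔼ⁱ(T, F) = 0` for all `i ≥ 2`. -/
def IsHereditary (T F : ObjectProperty C) : Prop :=
  ∀ i : ℕ, 2 ≤ i → ∀ X Y : C, T X → F Y → ∀ ε : P.ExtN i X Y, ε = 0

/-- `T^R = F^L = C`. -/
def IsBounded (T F : ObjectProperty C) : Prop :=
  P.rightClosure T = ⊤ ∧ P.leftClosure F = ⊤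

end ExtData

section Grothendieck

/-- The isomorphism classes of the objects of a full subcategory. -/
abbrev IsoClass (T : ObjectProperty C) : Type u :=
  Quotient (isIsomorphicSetoid T.FullSubcategory)

/-- The generator `[X]` of the free abelian group on the isomorphism classes. -/
def gen (T : ObjectProperty C) (X : C) (hX : T X) : FreeAbelianGroup (IsoClass T) :=
  .of (Quotient.mk (isIsomorphicSetoid T.FullSubcategory) ⟨X, hX⟩)

/-- The elements `[A ⊕ B] - [A] - [B]`. -/
inductive SplitRel (T : ObjectProperty C) : FreeAbelianGroup (IsoClass T) → Prop
  | mk (A B : C) (hA : T A) (hB : T B) (hAB : T (A ⊞ B)) :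
      SplitRel T (gen T (A ⊞ B) hAB - gen T A hA - gen T B hB)

/-- The split Grothendieck group of a full subcategory. -/
abbrev K0sp (T : ObjectProperty C) : Type u :=
  FreeAbelianGroup (IsoClass T) ⧸ AddSubgroup.closure {r | SplitRel T r}

/-- The class `[X]` in the split Grothendieck group. -/
def K0sp.cls (T : ObjectProperty C) (X : C) (hX : T X) : K0sp T :=
  QuotientAddGroup.mk (gen T X hX)

/-- The elements `[A] - [B] + [Z]` for the `𝔼`-triangles `A ⟶ B ⟶ Z ⇢` with terms in `T`. -/
inductive TriangleRel (P : ExtData.{w} C) (T : ObjectProperty C) : K0sp T → Prop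
  | mk (A B Z : C) (hA : T A) (hB : T B) (hZ : T Z) (h : P.Conflation A B Z) :
      TriangleRel P T (K0sp.cls T A hA - K0sp.cls T B hB + K0sp.cls T Z hZ)

/-- The Grothendieck group of a full subcategory of an extriangulated category. -/
abbrev K0 (P : ExtData.{w} C) (T : ObjectProperty C) : Type u :=
  K0sp T ⧸ AddSubgroup.closure {r | TriangleRel P T r}

/-- The class `[X]` in the Grothendieck group. -/
def K0.cls (P : ExtData.{w} C) (T : ObjectProperty C) (X : C) (hX : T X) : K0 P T :=
  QuotientAddGroup.mk (K0sp.cls T X hX)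

end Grothendieck

end Extri

/-!
Write `M = T ∩ F`. All three isomorphisms come from the inclusions of `M` into `T`, `F` and `C`:
`K₀ˢᵖ(M) ⟶ K₀(T)` and `K₀ˢᵖ(M) ⟶ K₀(F)` are onto, and `K₀ˢᵖ(M) ⟶ K₀(C)` is bijective, so that all
the maps between these groups are bijective.

*Closure properties.* The approximations give `T = {X | 𝔼(X, F) = 0}` and `F = {Y | 𝔼(T, Y) = 0}`,
so both classes are closed under extensions. The condition `𝔼²(T, F) = 0` enters only through the
closure of `T` under cocones (`IsCotorsionPair.cocone`), from which the closure of `F` under cones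
follows by an approximation argument. For the cocones one needs the exactness of
`𝔼(B, W) ⟶ 𝔼(A, W) ⟶ 𝔼²(Z, W)` for a conflation `A ⟶ B ⟶ Z` with class `δ`
(`IsTriangle.exists_pull_eq_of_extN_two`). The coend is a directed colimit over the pairs
`(Y, η ∈ 𝔼(Z, Y))` of the cokernels of `𝔼(B_η, W) ⟶ 𝔼(Y, W)`, where `Y ⟶ B_η ⟶ Z` realizes `η`;
`coendEval` evaluates formal sums of tensors in these cokernels, every relation of the coend
evaluates to zero sufficiently far in the system, and the transition maps are injective
(`IsTriangle.exists_pull_eq_of_push`).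

*Coresolutions.* The rest only uses the relation "there is a conflation `A ⟶ B ⟶ Z`" on objects, with
the axioms collected in `HereditaryPair`; these are self-dual, so each fact about `T` holds for `F`
as well. If `X` has an `F`-coresolution of length `n + 1`, then the cone of any inflation from `X` to
an object of `F` has one of length `n` (`HereditaryPair.coresolved_of_conf`). Hence for `X` in `T`
the approximations `X ⟶ M₀ ⟶ T₁`, `T₁ ⟶ M₁ ⟶ T₂`, … end after finitely many steps, which expresses
`[X]` through classes of objects of `M`. Dually for `F`, and for arbitrary `X` one uses
`F₁ ⟶ T₁ ⟶ X`. This gives the surjectivity.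

*The inverse.* Conflations in `M` split, so `X ↦ [X] ∈ K₀ˢᵖ(M)` is additive on `M`. The alternating
sum along such a coresolution extends it to an additive function `α` on `T` (Schanuel's lemma and an
induction on the length, `HereditaryPair.exists_additive_left`), and dually to `β` on `F`. Finally
`X ↦ α T₁ - β F₁` for a conflation `F₁ ⟶ T₁ ⟶ X` is well defined and additive on `C`
(`HereditaryPair.exists_additive_of_agree`), which gives the inverse `K₀(C) ⟶ K₀ˢᵖ(M)`.
-/

/-! ### Exact sequences, pushouts and pullbacks in extriangulated categories -/

namespace Extri

namespace ExtData

section Functoriality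

variable {C : Type u} [Category.{v} C] (P : ExtData.{w} C)

lemma push_id {Z A : C} (δ : P.Ext Z A) : P.push (𝟙 A) δ = δ := by
  simp [push]

lemma pull_id {Z A : C} (δ : P.Ext Z A) : P.pull (𝟙 Z) δ = δ := by
  simp [pull]

lemma push_comp {Z A A' A'' : C} (a : A ⟶ A') (a' : A' ⟶ A'') (δ : P.Ext Z A) :
    P.push (a ≫ a') δ = P.push a' (P.push a δ) := by
  simp [push]

lemma pull_comp {Z Z' Z'' A : C} (c : Z' ⟶ Z) (c' : Z'' ⟶ Z') (δ : P.Ext Z A) :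
    P.pull (c' ≫ c) δ = P.pull c' (P.pull c δ) := by
  simp [pull]

variable {P}

lemma exists_isTriangle {A Z : C} (δ : P.Ext Z A) :
    ∃ (B : C) (x : A ⟶ B) (y : B ⟶ Z), P.IsTriangle x y δ := by
  obtain ⟨S, hS⟩ := Quotient.exists_rep (P.s δ)
  exact ⟨S.mid, S.x, S.y, hS.symm⟩

/-- Two realizations of the same extension have isomorphic middle terms. -/
lemma IsTriangle.exists_iso {A B B' Z : C} {x : A ⟶ B} {y : B ⟶ Z} {x' : A ⟶ B'} {y' : B' ⟶ Z}
    {δ : P.Ext Z A} (h : P.IsTriangle x y δ) (h' : P.IsTriangle x' y' δ) :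
    ∃ b : B ≅ B', x ≫ b.hom = x' ∧ b.hom ≫ y' = y :=
  Quotient.exact (h.symm.trans h')

lemma IsTriangle.of_iso {A B B' Z : C} {x : A ⟶ B} {y : B ⟶ Z} {x' : A ⟶ B'} {y' : B' ⟶ Z}
    {δ : P.Ext Z A} (h : P.IsTriangle x y δ) (b : B ≅ B') (hx : x ≫ b.hom = x')
    (hy : b.hom ≫ y' = y) : P.IsTriangle x' y' δ :=
  h.trans (Quotient.sound ⟨b, hx, hy⟩)

end Functoriality

section Exactness

variable {C : Type u} [Category.{v} C] [Preadditive C] [HasBinaryBiproducts C]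
  {P : ExtData.{w} C} [P.IsExtriangulated]

variable (P) in
lemma push_sub {Z A A' : C} (a a' : A ⟶ A') (δ : P.Ext Z A) :
    P.push (a - a') δ = P.push a δ - P.push a' δ := by
  have := IsExtriangulated.additive_right (P := P) (op Z)
  simp [push, Functor.map_sub]

variable (P) in
lemma push_add {Z A A' : C} (a a' : A ⟶ A') (δ : P.Ext Z A) :
    P.push (a + a') δ = P.push a δ + P.push a' δ := by
  have := IsExtriangulated.additive_right (P := P) (op Z)
  simp [push, Functor.map_add]

variable (P) in
lemma push_zero {Z A A' : C} (δ : P.Ext Z A) : P.push (0 : A ⟶ A') δ = 0 := by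
  simpa using P.push_sub (0 : A ⟶ A') 0 δ

variable (P) in
lemma pull_sub {Z Z' A : C} (c c' : Z' ⟶ Z) (δ : P.Ext Z A) :
    P.pull (c - c') δ = P.pull c δ - P.pull c' δ := by
  have := IsExtriangulated.additive_left (P := P) A
  have h := (P.E.flip.obj A).map_sub (f := c.op) (g := c'.op)
  have h2 := congrArg (fun t => t.hom δ) h
  simpa [pull] using h2

variable (P) in
lemma pull_add {Z Z' A : C} (c c' : Z' ⟶ Z) (δ : P.Ext Z A) :
    P.pull (c + c') δ = P.pull c δ + P.pull c' δ := by
  have := IsExtriangulated.additive_left (P := P) A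
  have h := (P.E.flip.obj A).map_add (f := c.op) (g := c'.op)
  have h2 := congrArg (fun t => t.hom δ) h
  simpa [pull] using h2

variable (P) in
lemma pull_zero {Z Z' A : C} (δ : P.Ext Z A) : P.pull (0 : Z' ⟶ Z) δ = 0 := by
  simpa using P.pull_sub (0 : Z' ⟶ Z) 0 δ

variable (P) in
lemma push_fst_pair {Z A A' : C} (δ : P.Ext Z A) (δ' : P.Ext Z A') :
    P.push biprod.fst (P.push biprod.inl δ + P.push (biprod.inr : A' ⟶ A ⊞ A') δ') = δ := by
  rw [map_add, ← push_comp, ← push_comp, biprod.inl_fst, biprod.inr_fst, push_id, push_zero,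
    add_zero]

variable (P) in
lemma push_snd_pair {Z A A' : C} (δ : P.Ext Z A) (δ' : P.Ext Z A') :
    P.push biprod.snd (P.push biprod.inl δ + P.push (biprod.inr : A' ⟶ A ⊞ A') δ') = δ' := by
  rw [map_add, ← push_comp, ← push_comp, biprod.inl_snd, biprod.inr_snd, push_id, push_zero,
    zero_add]

/-- A split sequence realizes the zero extension. -/
lemma isTriangle_zero_of_split {A B Z : C} {i : A ⟶ B} {p : B ⟶ Z} {r : B ⟶ A} {j : Z ⟶ B}
    (hir : i ≫ r = 𝟙 A) (hjp : j ≫ p = 𝟙 Z) (hip : i ≫ p = 0) (hjr : j ≫ r = 0)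
    (htot : r ≫ i + p ≫ j = 𝟙 B) : P.IsTriangle i p 0 := by
  refine (IsExtriangulated.realize_zero (P := P) A Z).of_iso
    ⟨biprod.desc i j, biprod.lift r p, ?_, ?_⟩ (by simp) ?_
  · ext <;> simp [hir, hjp, hip, hjr]
  · simpa using htot
  · ext <;> simp [hjp, hip]

lemma IsTriangle.exists_split {A B Z : C} {i : A ⟶ B} {p : B ⟶ Z}
    (h : P.IsTriangle i p (0 : P.Ext Z A)) :
    ∃ (r : B ⟶ A) (j : Z ⟶ B), i ≫ r = 𝟙 A ∧ j ≫ p = 𝟙 Z := by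
  obtain ⟨b, h₁, h₂⟩ := (IsExtriangulated.realize_zero (P := P) A Z).exists_iso h
  refine ⟨b.inv ≫ biprod.fst, biprod.inr ≫ b.hom, ?_, ?_⟩
  · simp [← h₁]
  · simp [h₂]

lemma IsTriangle.nonempty_iso {A B Z : C} {i : A ⟶ B} {p : B ⟶ Z}
    (h : P.IsTriangle i p (0 : P.Ext Z A)) : Nonempty (B ≅ A ⊞ Z) := by
  obtain ⟨b, -, -⟩ := h.exists_iso (IsExtriangulated.realize_zero (P := P) A Z)
  exact ⟨b⟩

lemma conflation_biprod (A Z : C) : P.Conflation A (A ⊞ Z) Z :=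
  ⟨_, _, _, IsExtriangulated.realize_zero A Z⟩

lemma conflation_of_iso {A B Z : C} (e : A ≅ B) (hZ : IsZero Z) :
    P.Conflation A B Z :=
  ⟨e.hom, 0, 0, isTriangle_zero_of_split (r := e.inv) (j := 0) (by simp) (hZ.eq_of_src _ _)
    (by simp) (by simp) (by simp)⟩

lemma IsTriangle.exists_desc {A B Z W : C} {x : A ⟶ B} {y : B ⟶ Z} {δ : P.Ext Z A}
    (h : P.IsTriangle x y δ) (f : A ⟶ W) (hf : P.push f δ = 0) : ∃ g : B ⟶ W, x ≫ g = f := by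
  obtain ⟨b, hb, -⟩ := IsExtriangulated.realize h
    (IsExtriangulated.realize_zero W Z) f (𝟙 Z) (by simp [hf])
  exact ⟨b ≫ biprod.fst, by simp [reassoc_of% hb]⟩

lemma IsTriangle.exists_lift {A B Z W : C} {x : A ⟶ B} {y : B ⟶ Z} {δ : P.Ext Z A}
    (h : P.IsTriangle x y δ) (f : W ⟶ Z) (hf : P.pull f δ = 0) : ∃ g : W ⟶ B, g ≫ y = f := by
  obtain ⟨b, -, hb⟩ := IsExtriangulated.realize
    (IsExtriangulated.realize_zero A W) h (𝟙 A) f (by simp [hf])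
  exact ⟨biprod.inr ≫ b, by simp [← hb]⟩

/-- Exactness of `C(W, Z) ⟶ 𝔼(W, A) ⟶ 𝔼(W, B)`. -/
lemma IsTriangle.exists_pull_of_push_eq_zero {A B Z W : C} {x : A ⟶ B} {y : B ⟶ Z}
    {δ : P.Ext Z A} (h : P.IsTriangle x y δ) (θ : P.Ext W A) (hθ : P.push x θ = 0) :
    ∃ c : W ⟶ Z, P.pull c δ = θ := by
  obtain ⟨V, i, p, hV⟩ := exists_isTriangle θ
  obtain ⟨g, hg⟩ := hV.exists_desc x hθ
  obtain ⟨c, -, hc⟩ := IsExtriangulated.et3 hV h (𝟙 A) g (by simp [hg])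
  exact ⟨c, by rw [← hc, push_id]⟩

/-- Exactness of `C(A, W) ⟶ 𝔼(Z, W) ⟶ 𝔼(B, W)`. -/
lemma IsTriangle.exists_push_of_pull_eq_zero {A B Z W : C} {x : A ⟶ B} {y : B ⟶ Z}
    {δ : P.Ext Z A} (h : P.IsTriangle x y δ) (θ : P.Ext Z W) (hθ : P.pull y θ = 0) :
    ∃ a : A ⟶ W, P.push a δ = θ := by
  obtain ⟨V, i, p, hV⟩ := exists_isTriangle θ
  obtain ⟨g, hg⟩ := hV.exists_lift y hθ
  obtain ⟨a, -, ha⟩ := IsExtriangulated.et3_op h hV g (𝟙 Z) (by simp [hg])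
  exact ⟨a, by rw [ha, pull_id]⟩

/-- Exactness of `𝔼(Z, W) ⟶ 𝔼(B, W) ⟶ 𝔼(A, W)`. -/
lemma IsTriangle.exists_pull_eq {A B Z W : C} {x : A ⟶ B} {y : B ⟶ Z} {δ : P.Ext Z A}
    (h : P.IsTriangle x y δ) (β : P.Ext B W) (hβ : P.pull x β = 0) :
    ∃ θ : P.Ext Z W, P.pull y θ = β := by
  obtain ⟨V, i, p, hV⟩ := exists_isTriangle β
  obtain ⟨N, h', d, e, δ'', -, -, -, hN, -, hd⟩ := IsExtriangulated.et4_op hV h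
  rw [hβ] at hN
  obtain ⟨r, -, hr, -⟩ := hN.exists_split
  exact ⟨P.push r δ'', by rw [← push_pull, ← hd, ← push_comp, hr, push_id]⟩

/-- Exactness of `𝔼(W, A) ⟶ 𝔼(W, B) ⟶ 𝔼(W, Z)`. -/
lemma IsTriangle.exists_push_eq {A B Z W : C} {x : A ⟶ B} {y : B ⟶ Z} {δ : P.Ext Z A}
    (h : P.IsTriangle x y δ) (β : P.Ext W B) (hβ : P.push y β = 0) :
    ∃ θ : P.Ext W A, P.push x θ = β := by
  obtain ⟨V, i, p, hV⟩ := exists_isTriangle β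
  obtain ⟨N, h', d, e, δ'', -, -, -, hN, -, hd⟩ := IsExtriangulated.et4 h hV
  rw [hβ] at hN
  obtain ⟨-, s, -, hs⟩ := hN.exists_split
  exact ⟨P.pull s δ'', by rw [push_pull, hd, ← pull_comp, hs, pull_id]⟩

open ZeroObject

variable [HasZeroObject C]

lemma IsTriangle.comp_eq_zero {A B Z : C} {x : A ⟶ B} {y : B ⟶ Z} {δ : P.Ext Z A}
    (h : P.IsTriangle x y δ) : x ≫ y = 0 := by
  obtain ⟨c, hc, -⟩ := IsExtriangulated.et3 (IsExtriangulated.realize_zero (P := P) A (0 : C)) h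
    (𝟙 A) (biprod.fst ≫ x) (by simp)
  have := congrArg (fun t => biprod.inl ≫ t) hc
  simpa using this.symm

lemma IsTriangle.exists_desc_right {A B Z W : C} {x : A ⟶ B} {y : B ⟶ Z} {δ : P.Ext Z A}
    (h : P.IsTriangle x y δ) (g : B ⟶ W) (hg : x ≫ g = 0) : ∃ k : Z ⟶ W, y ≫ k = g := by
  obtain ⟨c, hc, -⟩ := IsExtriangulated.et3 h (IsExtriangulated.realize_zero (P := P) (0 : C) W)
    0 (g ≫ biprod.inr) (by simp [reassoc_of% hg])
  exact ⟨c, by simpa using hc⟩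

/-- An endomorphism of the middle term that is compatible with the two maps of a conflation differs
from the identity by an endomorphism of square zero, so it is invertible. -/
lemma IsTriangle.endo_comp_two_sub {A B Z : C} {x : A ⟶ B} {y : B ⟶ Z} {δ : P.Ext Z A}
    (h : P.IsTriangle x y δ) (c : B ⟶ B) (hx : x ≫ c = x) (hy : c ≫ y = y) :
    c ≫ (𝟙 B + 𝟙 B - c) = 𝟙 B ∧ (𝟙 B + 𝟙 B - c) ≫ c = 𝟙 B := by
  obtain ⟨k, hk⟩ := h.exists_desc_right (c - 𝟙 B) (by simp [hx])
  have h0 : (c - 𝟙 B) ≫ (c - 𝟙 B) = 0 := by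
    nth_rw 2 [← hk]
    simp [reassoc_of% hy]
  have h1 : c ≫ c = c + c - 𝟙 B := by
    rw [← sub_eq_zero, ← h0]
    simp only [Preadditive.comp_sub, Preadditive.sub_comp, Category.comp_id, Category.id_comp]
    abel
  constructor <;>
  · simp only [Preadditive.comp_sub, Preadditive.sub_comp, Preadditive.comp_add,
      Preadditive.add_comp, Category.comp_id, Category.id_comp, h1]
    abel

lemma IsTriangle.exists_iso_of_push_eq_pull {A B B' Z : C} {x : A ⟶ B} {y : B ⟶ Z} {δ : P.Ext Z A}
    {A' Z' : C} {x' : A' ⟶ B'} {y' : B' ⟶ Z'} {δ' : P.Ext Z' A'}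
    (h : P.IsTriangle x y δ) (h' : P.IsTriangle x' y' δ') (a : A ≅ A') (c : Z ≅ Z')
    (hac : P.push a.hom δ = P.pull c.hom δ') :
    ∃ b : B ≅ B', x ≫ b.hom = a.hom ≫ x' ∧ y ≫ c.hom = b.hom ≫ y' := by
  obtain ⟨b, hb₁, hb₂⟩ := IsExtriangulated.realize h h' a.hom c.hom hac
  obtain ⟨b', hb₁', hb₂'⟩ := IsExtriangulated.realize h' h a.inv c.inv (by
    rw [← P.pull_id (P.push a.inv δ'), ← c.inv_hom_id, pull_comp, ← push_pull, ← hac,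
      ← push_comp, a.hom_inv_id, push_id])
  obtain ⟨h₁, -⟩ := h.endo_comp_two_sub (b ≫ b') (by simp [reassoc_of% hb₁, hb₁'])
    (by rw [Category.assoc, ← hb₂', ← reassoc_of% hb₂]; simp)
  obtain ⟨-, h₂⟩ := h'.endo_comp_two_sub (b' ≫ b) (by simp [reassoc_of% hb₁', hb₁])
    (by rw [Category.assoc, ← hb₂, ← reassoc_of% hb₂']; simp)
  have hm : IsSplitMono b := ⟨⟨⟨_, (Category.assoc _ _ _).symm.trans h₁⟩⟩⟩
  have he : Epi b := by
    have : IsSplitEpi b := ⟨⟨⟨_, (Category.assoc _ _ _).trans h₂⟩⟩⟩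
    infer_instance
  have := isIso_of_epi_of_isSplitMono b
  exact ⟨asIso b, hb₁, hb₂⟩

lemma Conflation.of_iso_left {A A' B Z : C} (h : P.Conflation A B Z) (a : A ≅ A') :
    P.Conflation A' B Z := by
  obtain ⟨x, y, δ, h⟩ := h
  obtain ⟨B', x', y', h'⟩ := exists_isTriangle (P.push a.hom δ)
  obtain ⟨b, hb₁, hb₂⟩ := h.exists_iso_of_push_eq_pull h' a (Iso.refl Z) (by simp [pull_id])
  exact ⟨a.inv ≫ x, y, _, h'.of_iso b.symm (by simp [← cancel_epi a.hom, ← reassoc_of% hb₁])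
    (by simp [← cancel_epi b.hom, ← hb₂])⟩

lemma Conflation.of_iso_right {A B Z Z' : C} (h : P.Conflation A B Z) (c : Z ≅ Z') :
    P.Conflation A B Z' := by
  obtain ⟨x, y, δ, h⟩ := h
  obtain ⟨B', x', y', h'⟩ := exists_isTriangle (P.pull c.inv δ)
  obtain ⟨b, hb₁, hb₂⟩ := h.exists_iso_of_push_eq_pull h' (Iso.refl A) c (by
    simp [← pull_comp, pull_id, push_id])
  exact ⟨x, y ≫ c.hom, _, h'.of_iso b.symm (by simpa using hb₁.symm =≫ b.inv)
    (by simp [← cancel_epi b.hom, ← hb₂])⟩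

/-- If `d, e` are the maps of a split sequence, then every section `s` of `e` can be completed to a
split sequence in the other direction. -/
lemma IsTriangle.of_section {A B Z : C} {d : A ⟶ B} {e : B ⟶ Z}
    (h : P.IsTriangle d e (0 : P.Ext Z A)) (s : Z ⟶ B) (hs : s ≫ e = 𝟙 Z) :
    ∃ r : B ⟶ A, P.IsTriangle s r (0 : P.Ext A Z) := by
  obtain ⟨b, h₁, h₂⟩ := (IsExtriangulated.realize_zero (P := P) A Z).exists_iso h
  have hde := h.comp_eq_zero
  have hbe : b.inv ≫ biprod.snd = e := by rw [← h₂]; simp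
  have hd : d ≫ b.inv = biprod.inl := by rw [← h₁]; simp
  have htot : b.inv ≫ biprod.fst ≫ d + e ≫ biprod.inr ≫ b.hom = 𝟙 B := by
    rw [← hbe, ← h₁]
    have := congrArg (fun t => b.inv ≫ t ≫ b.hom) (biprod.total (X := A) (Y := Z))
    simpa only [Preadditive.add_comp, Preadditive.comp_add, Category.assoc, Category.id_comp,
      Iso.inv_hom_id] using this
  have hsd : s ≫ b.inv ≫ biprod.fst ≫ d = s - biprod.inr ≫ b.hom := by
    have := congrArg (fun t => s ≫ t) htot
    simp only [Preadditive.comp_add, reassoc_of% hs, Category.comp_id] at this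
    exact eq_sub_of_add_eq this
  refine ⟨b.inv ≫ biprod.fst - e ≫ s ≫ b.inv ≫ biprod.fst,
    isTriangle_zero_of_split (r := e) (j := d) hs ?_ ?_ hde ?_⟩
  · simp [reassoc_of% hd, reassoc_of% hde]
  · simp [reassoc_of% hs]
  · simp only [Preadditive.sub_comp, Category.assoc, hsd, Preadditive.comp_sub]
    rw [← htot]; abel

/-- Dually, every retraction `r` of `d` can be completed to a split sequence. -/
lemma IsTriangle.of_retraction {A B Z : C} {d : A ⟶ B} {e : B ⟶ Z}
    (h : P.IsTriangle d e (0 : P.Ext Z A)) (r : B ⟶ A) (hr : d ≫ r = 𝟙 A) :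
    ∃ s : Z ⟶ B, P.IsTriangle s r (0 : P.Ext A Z) := by
  obtain ⟨b, h₁, h₂⟩ := (IsExtriangulated.realize_zero (P := P) A Z).exists_iso h
  have hde := h.comp_eq_zero
  have hbe : b.inv ≫ biprod.snd = e := by rw [← h₂]; simp
  have htot : b.inv ≫ biprod.fst ≫ d + e ≫ biprod.inr ≫ b.hom = 𝟙 B := by
    rw [← hbe, ← h₁]
    have := congrArg (fun t => b.inv ≫ t ≫ b.hom) (biprod.total (X := A) (Y := Z))
    simpa only [Preadditive.add_comp, Preadditive.comp_add, Category.assoc, Category.id_comp,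
      Iso.inv_hom_id] using this
  have hrd : e ≫ biprod.inr ≫ b.hom ≫ r = r - b.inv ≫ biprod.fst := by
    have := congrArg (fun t => t ≫ r) htot
    simp only [Preadditive.add_comp, Category.assoc, hr, Category.comp_id, Category.id_comp] at this
    exact eq_sub_of_add_eq' this
  refine ⟨biprod.inr ≫ b.hom - biprod.inr ≫ b.hom ≫ r ≫ d,
    isTriangle_zero_of_split (r := e) (j := d) ?_ hr ?_ hde ?_⟩
  · simp [h₂, hde]
  · simp [hr]
  · simp only [Preadditive.comp_sub]
    have := congrArg (fun t => t ≫ d) hrd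
    simp only [Category.assoc, Preadditive.sub_comp] at this
    rw [this, ← htot]; abel

/-- Two conflations starting at `A` have a common pushout. -/
lemma Conflation.exists_pushout {A B D B' D' : C} (h : P.Conflation A B D)
    (h' : P.Conflation A B' D') : ∃ U, P.Conflation B U D' ∧ P.Conflation B' U D := by
  obtain ⟨f, f', δ, hδ⟩ := h
  obtain ⟨k, k', δ', hδ'⟩ := h'
  obtain ⟨U, g, g', hU⟩ := exists_isTriangle (P.push f δ')
  refine ⟨U, ⟨_, _, _, hU⟩, ?_⟩
  obtain ⟨X, h', d, e, δ'', hX, -, -, hde, hd, he⟩ := IsExtriangulated.et4 hδ hU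
  rw [← push_comp, hδ.comp_eq_zero, push_zero] at hde
  -- a section `s` of `e` along which `δ''` restricts to `δ'`
  obtain ⟨-, s₀, -, hs₀⟩ := hde.exists_split
  obtain ⟨c, hc⟩ := hδ.exists_pull_of_push_eq_zero (P.pull s₀ δ'' - δ') (by
    rw [map_sub, push_pull, he, ← pull_comp, hs₀, pull_id, sub_self])
  obtain ⟨r, hr⟩ := hde.of_section (s₀ - c ≫ d) (by simp [hs₀, hde.comp_eq_zero])
  have hs : P.pull (s₀ - c ≫ d) δ'' = δ' := by
    rw [pull_sub, pull_comp, hd, hc]; abel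
  obtain ⟨V, i, p, q, θ, hV, -, -, hV', -, -⟩ := IsExtriangulated.et4_op hX hr
  rw [hs] at hV'
  obtain ⟨b, -, -⟩ := hV'.exists_iso hδ'
  exact Conflation.of_iso_left ⟨_, _, _, hV⟩ b

/-- Two conflations ending at `A` have a common pullback. -/
lemma Conflation.exists_pullback {A B D B' D' : C} (h : P.Conflation D B A)
    (h' : P.Conflation D' B' A) : ∃ U, P.Conflation D' U B ∧ P.Conflation D U B' := by
  obtain ⟨f', f, δ, hδ⟩ := h
  obtain ⟨k, k', δ', hδ'⟩ := h'
  obtain ⟨U, g', g, hU⟩ := exists_isTriangle (P.pull f δ')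
  refine ⟨U, ⟨_, _, _, hU⟩, ?_⟩
  obtain ⟨X, h', d, e, δ'', hX, -, -, hde, he, hd⟩ := IsExtriangulated.et4_op hU hδ
  rw [← pull_comp, hδ.comp_eq_zero, pull_zero] at hde
  -- a retraction `r` of `d` that sends `δ''` to `δ'`
  obtain ⟨r₀, -, hr₀, -⟩ := hde.exists_split
  obtain ⟨c, hc⟩ := hδ.exists_push_of_pull_eq_zero (P.push r₀ δ'' - δ') (by
    rw [map_sub, ← push_pull, ← hd, ← push_comp, hr₀, push_id, sub_self])
  obtain ⟨s, hs⟩ := hde.of_retraction (r₀ - e ≫ c) (by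
    simp [hr₀, reassoc_of% hde.comp_eq_zero])
  have hr : P.push (r₀ - e ≫ c) δ'' = δ' := by
    rw [push_sub, push_comp, he, hc]; abel
  obtain ⟨V, i, p, q, θ, hV, -, -, hV', -, -⟩ := IsExtriangulated.et4 hs hX
  rw [hr] at hV'
  obtain ⟨b, -, -⟩ := hV'.exists_iso hδ'
  exact Conflation.of_iso_right ⟨_, _, _, hV⟩ b

end Exactness

end ExtData
end Extri

/-! ### Coresolutions and additive functions, on objects -/

namespace Extri

/-- The part of a hereditary cotorsion pair `(T, F)` that is visible on objects: `Conf A B Z` says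
that there is a conflation `A ⟶ B ⟶ Z`. The axioms are stable under reversing `Conf` and exchanging
`T` and `F`. -/
structure HereditaryPair {O : Type*} (Conf : O → O → O → Prop) (T F : O → Prop) : Prop where
  et4 : ∀ {A B D Z W}, Conf A B D → Conf B Z W → ∃ X, Conf A Z X ∧ Conf D X W
  et4_op : ∀ {A B D Z W}, Conf D A B → Conf W B Z → ∃ X, Conf X A Z ∧ Conf D X W
  pushout : ∀ {A B D B' D'}, Conf A B D → Conf A B' D' → ∃ U, Conf B U D' ∧ Conf B' U D
  pullback : ∀ {A B D B' D'}, Conf D B A → Conf D' B' A → ∃ U, Conf D' U B ∧ Conf D U B'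
  ext_left : ∀ {A B Z}, Conf A B Z → T A → T Z → T B
  ext_right : ∀ {A B Z}, Conf A B Z → F A → F Z → F B
  cocone : ∀ {A B Z}, Conf A B Z → T B → T Z → T A
  cone : ∀ {A B Z}, Conf A B Z → F A → F B → F Z
  exists_left : ∀ X, ∃ F₁ T₁, F F₁ ∧ T T₁ ∧ Conf F₁ T₁ X
  exists_right : ∀ X, ∃ F₂ T₂, F F₂ ∧ T T₂ ∧ Conf X F₂ T₂

/-- The objects with a coresolution of length `n` by objects of `M`. -/
def Coresolved {O : Type*} (Conf : O → O → O → Prop) (M : O → Prop) : ℕ → O → Prop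
  | 0 => M
  | n + 1 => fun X => ∃ Y K, M Y ∧ Coresolved Conf M n K ∧ Conf X Y K

namespace HereditaryPair

variable {O : Type*} {Conf : O → O → O → Prop} {T F : O → Prop}

lemma dual (h : HereditaryPair Conf T F) :
    HereditaryPair (fun A B Z => Conf Z B A) F T where
  et4 h₁ h₂ := h.et4_op h₂ h₁ |>.imp fun _ h => ⟨h.1, h.2⟩
  et4_op h₁ h₂ := h.et4 h₂ h₁ |>.imp fun _ h => ⟨h.1, h.2⟩
  pushout h₁ h₂ := h.pullback h₁ h₂
  pullback h₁ h₂ := h.pushout h₁ h₂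
  ext_left h₁ h₂ h₃ := h.ext_right h₁ h₃ h₂
  ext_right h₁ h₂ h₃ := h.ext_left h₁ h₃ h₂
  cocone h₁ h₂ h₃ := h.cone h₁ h₃ h₂
  cone h₁ h₂ h₃ := h.cocone h₁ h₃ h₂
  exists_left X := by
    obtain ⟨A, B, hA, hB, h⟩ := h.exists_right X
    exact ⟨B, A, hB, hA, h⟩
  exists_right X := by
    obtain ⟨A, B, hA, hB, h⟩ := h.exists_left X
    exact ⟨B, A, hB, hA, h⟩

variable (h : HereditaryPair Conf T F)
include h

/-- In a conflation `A ⟶ B ⟶ Z` with `A` in `F`, the outer term `Z` has a coresolution of length `n`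
by objects of `F` if and only if `B` has one. -/
lemma coresolved_iff (n : ℕ) {A B Z : O} (hc : Conf A B Z) (hA : F A) :
    Coresolved Conf F n B ↔ Coresolved Conf F n Z := by
  induction n generalizing A B Z with
  | zero => exact ⟨fun hB => h.cone hc hA hB, fun hZ => h.ext_right hc hA hZ⟩
  | succ n ih =>
    constructor
    · rintro ⟨Y, K, hY, hK, hB⟩
      obtain ⟨X, h₁, h₂⟩ := h.et4 hc hB
      exact ⟨X, K, h.cone h₁ hA hY, hK, h₂⟩
    · rintro ⟨Y, K, hY, hK, hZ⟩
      obtain ⟨F', T', hF', -, hB⟩ := h.exists_right B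
      obtain ⟨W, h₁, h₂⟩ := h.et4 hc hB
      obtain ⟨U, h₃, h₄⟩ := h.pushout h₂ hZ
      exact ⟨F', T', hF', (ih h₄ hY).1 ((ih h₃ (h.cone h₁ hA hF')).2 hK), hB⟩

/-- Every embedding into an object of `F` lowers the length of a coresolution by one. -/
lemma coresolved_of_conf {n : ℕ} {X Y K : O} (hX : Coresolved Conf F (n + 1) X)
    (hc : Conf X Y K) (hY : F Y) : Coresolved Conf F n K := by
  obtain ⟨Y', K', hY', hK', hX⟩ := hX
  obtain ⟨U, h₁, h₂⟩ := h.pushout hc hX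
  exact (h.coresolved_iff n h₂ hY').1 ((h.coresolved_iff n h₁ hY).2 hK')

lemma coresolved_succ {n : ℕ} {X : O} (hX : Coresolved Conf F n X) :
    Coresolved Conf F (n + 1) X := by
  induction n generalizing X with
  | zero =>
    obtain ⟨F', T', hF', -, hc⟩ := h.exists_right X
    exact ⟨F', T', hF', h.cone hc hX hF', hc⟩
  | succ n ih =>
    obtain ⟨Y, K, hY, hK, hX⟩ := hX
    exact ⟨Y, K, hY, ih hK, hX⟩

lemma coresolved_mono {n k : ℕ} (hnk : n ≤ k) {X : O} (hX : Coresolved Conf F n X) :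
    Coresolved Conf F k X := by
  induction hnk with
  | refl => exact hX
  | step _ ih => exact h.coresolved_succ ih

/-- Objects of `T` are coresolved by objects of `T ∩ F`, so a property that holds on `T ∩ F` and
passes from the cone to the first term of such a conflation holds on `T`. -/
lemma induction_left (hF : ∀ X, ∃ n, Coresolved Conf F n X) {Q : O → Prop}
    (hM : ∀ X, T X → F X → Q X)
    (hQ : ∀ X Y K, Conf X Y K → T X → T Y → F Y → T K → Q K → Q X) {X : O} (hX : T X) : Q X := by
  obtain ⟨n, hn⟩ := hF X
  induction n generalizing X with
  | zero => exact hM X hX hn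
  | succ n ih =>
    obtain ⟨Y, K, hY, hK, hc⟩ := h.exists_right X
    exact hQ X Y K hc hX (h.ext_left hc hX hK) hY hK (ih hK (h.coresolved_of_conf hn hc hY))

section Euler

variable {G : Type*} [AddCommGroup G]

omit h in
/-- The alternating sum of the values of `m` along the coresolution of `X` by the chosen embeddings
`X ⟶ I X` with cone `S X`, broken off after `n` steps. -/
noncomputable def euler (m : O → G) (I S : O → O) : ℕ → O → G
  | 0 => m
  | n + 1 => fun X => m (I X) - euler m I S n (S X)

/-- Additive functions on `T ∩ F` extend to additive functions on `T`. -/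
lemma exists_additive_left (hF : ∀ X, ∃ n, Coresolved Conf F n X) (m : O → G)
    (hm : ∀ A B Z, Conf A B Z → T A → F A → T B → F B → T Z → F Z → m B = m A + m Z) :
    ∃ χ : O → G, (∀ X, T X → F X → χ X = m X) ∧
      ∀ A B Z, Conf A B Z → T A → T B → T Z → χ B = χ A + χ Z := by
  choose I S hI hS hc using h.exists_right
  have hIT {X : O} (hX : T X) : T (I X) := h.ext_left (hc X) hX (hS X)
  have hSn {n X} (hX : Coresolved Conf F (n + 1) X) : Coresolved Conf F n (S X) :=
    h.coresolved_of_conf hX (hc X) (hI X)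
  have hF0 {n X} (hX : F X) : Coresolved Conf F n X := h.coresolved_mono (Nat.zero_le n) hX
  let e := euler m I S
  have he (n X) : e (n + 1) X = m (I X) - e n (S X) := rfl
  -- `e n` agrees with `m` on `T ∩ F`
  have e_core (n X) (hT : T X) (hFX : F X) : e n X = m X := by
    induction n generalizing X with
    | zero => rfl
    | succ n ih =>
      have hSF := h.cone (hc X) hFX (hI X)
      rw [he, ih _ (hS X) hSF, hm _ _ _ (hc X) hT hFX (hIT hT) (hI X) (hS X) hSF]
      abel
  -- Schanuel's lemma: `m Y - e n K` does not depend on the embedding `X ⟶ Y` with cone `K`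
  have schanuel (n) (ih : ∀ A B Z, Conf A B Z → T A → T B → T Z → Coresolved Conf F n A →
      Coresolved Conf F n B → Coresolved Conf F n Z → e n B = e n A + e n Z)
      {X Y K} (hXY : Conf X Y K) (hY : F Y) (hTX : T X) (hK : T K)
      (hX : Coresolved Conf F (n + 1) X) : e (n + 1) X = m Y - e n K := by
    have hTY := h.ext_left hXY hTX hK
    have hKn := h.coresolved_of_conf hX hXY hY
    obtain ⟨U, h₁, h₂⟩ := h.pushout (hc X) hXY
    have hTU := h.ext_left h₁ (hIT hTX) hK
    have hUn := (h.coresolved_iff n h₁ (hI X)).2 hKn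
    have e₁ := ih _ _ _ h₁ (hIT hTX) hTU hK (hF0 (hI X)) hUn hKn
    have e₂ := ih _ _ _ h₂ hTY hTU (hS X) (hF0 hY) hUn (hSn hX)
    rw [e_core n _ (hIT hTX) (hI X)] at e₁
    rw [e_core n _ hTY hY] at e₂
    rw [he, sub_eq_sub_iff_add_eq_add, ← e₁, e₂]
  have add (n) : ∀ A B Z, Conf A B Z → T A → T B → T Z → Coresolved Conf F n A →
      Coresolved Conf F n B → Coresolved Conf F n Z → e n B = e n A + e n Z := by
    induction n with
    | zero => exact fun A B Z hABZ hA hB hZ hA' hB' hZ' => hm A B Z hABZ hA hA' hB hB' hZ hZ'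
    | succ n ih =>
      intro A B Z hABZ hA hB hZ hA' hB' hZ'
      obtain ⟨U, hU₁, hU₂⟩ := h.pushout hABZ (hc A)
      have hTU := h.ext_left hU₁ hB (hS A)
      obtain ⟨X, hX₁, hX₂⟩ := h.et4 hU₁ (hc U)
      obtain ⟨X', hX₁', hX₂'⟩ := h.et4 hU₂ (hc U)
      have hTX := h.ext_left hX₂ (hS A) (hS U)
      have hTX' := h.ext_left hX₂' hZ (hS U)
      have hFX' := h.cone hX₁' (hI A) (hI U)
      have hUn := (h.coresolved_iff (n + 1) hU₂ (hI A)).2 hZ'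
      have e₁ := hm _ _ _ hX₁' (hIT hA) (hI A) (hIT hTU) (hI U) hTX' hFX'
      have e₂ := ih _ _ _ hX₂ (hS A) hTX (hS U) (hSn hA')
        (h.coresolved_of_conf hB' hX₁ (hI U)) (hSn hUn)
      rw [schanuel n ih hX₁ (hI U) hB hTX hB', schanuel n ih hX₂' hFX' hZ (hS U) hZ', he, e₁, e₂]
      abel
  have e_succ (n X) (hT : T X) (hX : Coresolved Conf F n X) : e (n + 1) X = e n X := by
    induction n generalizing X with
    | zero => exact e_core 1 X hT hX
    | succ n ih => rw [he (n + 1) X, he n X, ih _ (hS X) (hSn hX)]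
  have e_mono {n k X} (hnk : n ≤ k) (hT : T X) (hX : Coresolved Conf F n X) : e k X = e n X := by
    induction hnk with
    | refl => rfl
    | step hle ih => rw [e_succ _ _ hT (h.coresolved_mono hle hX), ih]
  choose d hd using hF
  refine ⟨fun X => e (d X) X, fun X => e_core _ X, fun A B Z hABZ hA hB hZ => ?_⟩
  have hAn : d A ≤ d A + d B + d Z := by omega
  have hBn : d B ≤ d A + d B + d Z := by omega
  have hZn : d Z ≤ d A + d B + d Z := by omega
  simp only [← e_mono hAn hA (hd A), ← e_mono hBn hB (hd B), ← e_mono hZn hZ (hd Z)]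
  exact add _ _ _ _ hABZ hA hB hZ (h.coresolved_mono hAn (hd A)) (h.coresolved_mono hBn (hd B))
    (h.coresolved_mono hZn (hd Z))

/-- Additive functions on `T` and on `F` that agree on `T ∩ F` come from an additive function on all
objects: it sends `X` to `α T₁ - β F₁` for any conflation `F₁ ⟶ T₁ ⟶ X`. -/
lemma exists_additive_of_agree (α β : O → G) (hαβ : ∀ X, T X → F X → α X = β X)
    (hα : ∀ A B Z, Conf A B Z → T A → T B → T Z → α B = α A + α Z)
    (hβ : ∀ A B Z, Conf A B Z → F A → F B → F Z → β B = β A + β Z) :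
    ∃ χ : O → G, (∀ X, T X → F X → χ X = α X) ∧
      ∀ A B Z, Conf A B Z → χ B = χ A + χ Z := by
  -- two approximations of `X` are compared through an approximation of their pullback
  have key {A A' X B B'} (hA : F A) (hB : T B) (h₁ : Conf A B X) (hA' : F A') (hB' : T B')
      (h₂ : Conf A' B' X) : α B - β A = α B' - β A' := by
    obtain ⟨U, hU₁, hU₂⟩ := h.pullback h₁ h₂
    obtain ⟨F₁, T₁, hF₁, hT₁, hc⟩ := h.exists_left U
    have aux {D E} (hD : F D) (hE : T E) (hU : Conf D U E) : α T₁ - β F₁ = α E + β D := by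
      obtain ⟨N, hN₁, hN₂⟩ := h.et4_op hc hU
      have hTN := h.cocone hN₁ hT₁ hE
      have hFN := h.ext_right hN₂ hF₁ hD
      rw [hα _ _ _ hN₁ hTN hT₁ hE, hαβ N hTN hFN, hβ _ _ _ hN₂ hF₁ hFN hD]
      abel
    rw [sub_eq_sub_iff_add_eq_add, ← aux hA' hB hU₁, aux hA hB' hU₂]
  choose A B hA hB hc using h.exists_left
  refine ⟨fun X => α (B X) - β (A X), fun X hT _ => ?_, fun X Y Z hXYZ => ?_⟩
  · have hTA := h.cocone (hc X) (hB X) hT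
    change α (B X) - β (A X) = α X
    rw [hα _ _ _ (hc X) hTA (hB X) hT, hαβ _ hTA (hA X)]
    abel
  · obtain ⟨U, hU₁, hU₂⟩ := h.pullback hXYZ (hc Z)
    -- the kernels `N` of `B U ⟶ B Z` and `L` of `B U ⟶ Y` give new approximations of `X` and `Y`
    obtain ⟨N, hN₁, hN₂⟩ := h.et4_op (hc U) hU₂
    obtain ⟨L, hL₁, hL₂⟩ := h.et4_op (hc U) hU₁
    have hTN := h.cocone hN₁ (hB U) (hB Z)
    have hFL := h.ext_right hL₂ (hA U) (hA Z)
    simp only [key (hA Y) (hB Y) (hc Y) hFL (hB U) hL₁, key (hA X) (hB X) (hc X) (hA U) hTN hN₂,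
      hα _ _ _ hN₁ hTN (hB U) (hB Z), hβ _ _ _ hL₂ (hA U) hFL (hA Z)]
    abel

/-- Additive functions on `T ∩ F` extend to additive functions on all objects. -/
lemma exists_additive (hF : ∀ X, ∃ n, Coresolved Conf F n X)
    (hT : ∀ X, ∃ n, Coresolved (fun A B Z => Conf Z B A) T n X) (m : O → G)
    (hm : ∀ A B Z, Conf A B Z → T A → F A → T B → F B → T Z → F Z → m B = m A + m Z) :
    ∃ χ : O → G, (∀ X, T X → F X → χ X = m X) ∧
      ∀ A B Z, Conf A B Z → χ B = χ A + χ Z := by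
  obtain ⟨α, hα₁, hα₂⟩ := h.exists_additive_left hF m hm
  obtain ⟨β, hβ₁, hβ₂⟩ := h.dual.exists_additive_left hT m fun A B Z hc a b c d e f => by
    rw [hm _ _ _ hc f e d c b a, add_comm]
  obtain ⟨χ, hχ₁, hχ₂⟩ := h.exists_additive_of_agree α β
    (fun X hT hF => by rw [hα₁ X hT hF, hβ₁ X hF hT]) hα₂
    (fun A B Z hc hA hB hZ => by rw [hβ₂ _ _ _ hc hZ hB hA, add_comm])
  exact ⟨χ, fun X hT hF => by rw [hχ₁ X hT hF, hα₁ X hT hF], hχ₂⟩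

end Euler

end HereditaryPair
end Extri

namespace Extri

namespace ExtData

/-! ### Filtrations as coresolutions -/

section Filtrations

variable {C : Type u} [Category.{v} C] {P : ExtData.{w} C}

lemma leftFilt_iff_coresolved (M : ObjectProperty C) (n : ℕ) (X : C) :
    P.leftFilt M n X ↔ Coresolved P.Conflation M n X := by
  induction n generalizing X with
  | zero => rfl
  | succ n ih => simp only [leftFilt, Coresolved, ih]

lemma rightFilt_iff_coresolved (M : ObjectProperty C) (n : ℕ) (X : C) :
    P.rightFilt M n X ↔ Coresolved (fun A B Z => P.Conflation Z B A) M n X := by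
  induction n generalizing X with
  | zero => rfl
  | succ n ih => simp only [rightFilt, Coresolved, ih]

end Filtrations

variable {C : Type u} [Category.{v} C] [Preadditive C] [HasBinaryBiproducts C]
  {P : ExtData.{w} C} [P.IsExtriangulated]

/-! ### Detecting the vanishing of elementary tensors in `𝔼²` -/

/-- If `δ` lifts along the deflation of a conflation with class `ε`, then `ε` extends along the
inflation of a conflation with class `δ`. -/
lemma IsTriangle.exists_pull_eq_of_push_eq {A B Z V W : C} {x : A ⟶ B} {y : B ⟶ Z} {δ : P.Ext Z A}
    (h : P.IsTriangle x y δ) {i : W ⟶ V} {p : V ⟶ A} {ε : P.Ext A W} (h' : P.IsTriangle i p ε)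
    (δ' : P.Ext Z V) (hδ : P.push p δ' = δ) : ∃ ζ : P.Ext B W, P.pull x ζ = ε := by
  obtain ⟨U, g, g', hU⟩ := exists_isTriangle δ'
  obtain ⟨X, -, d, e, δ'', -, -, -, hde, hd, -⟩ := IsExtriangulated.et4 h' hU
  rw [hδ] at hde
  obtain ⟨b, hb, -⟩ := h.exists_iso hde
  exact ⟨P.pull b.hom δ'', by rw [← pull_comp, hb, hd]⟩

/-- The converse of `IsTriangle.exists_pull_eq_of_push_eq`. -/
lemma IsTriangle.exists_push_eq_of_pull_eq {A B Z V W : C} {x : A ⟶ B} {y : B ⟶ Z} {δ : P.Ext Z A}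
    (h : P.IsTriangle x y δ) {i : W ⟶ V} {p : V ⟶ A} {ε : P.Ext A W} (h' : P.IsTriangle i p ε)
    (ζ : P.Ext B W) (hε : P.pull x ζ = ε) : ∃ δ' : P.Ext Z V, P.push p δ' = δ := by
  obtain ⟨U, g, g', hU⟩ := exists_isTriangle ζ
  obtain ⟨X, -, d, e, δ'', -, -, -, hde, he, -⟩ := IsExtriangulated.et4_op hU h
  rw [hε] at hde
  obtain ⟨b, -, hb⟩ := hde.exists_iso h'
  exact ⟨P.push b.hom δ'', by rw [← push_comp, hb, he]⟩

/-- The transition maps of the colimit computing the coend are injective. -/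
lemma IsTriangle.exists_pull_eq_of_push {Y A B B' Z W : C} {x : Y ⟶ B} {y : B ⟶ Z} {η : P.Ext Z Y}
    (h : P.IsTriangle x y η) {x' : A ⟶ B'} {y' : B' ⟶ Z} {δ : P.Ext Z A}
    (h' : P.IsTriangle x' y' δ) (f : Y ⟶ A) (hf : P.push f η = δ) (ε : P.Ext A W)
    (ζ : P.Ext B W) (hε : P.pull x ζ = P.pull f ε) : ∃ ζ' : P.Ext B' W, P.pull x' ζ' = ε := by
  obtain ⟨V, i, p, hV⟩ := exists_isTriangle ε
  obtain ⟨V', i', p', hV'⟩ := exists_isTriangle (P.pull f ε)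
  obtain ⟨η', hη'⟩ := h.exists_push_eq_of_pull_eq hV' ζ hε
  obtain ⟨φ, -, hφ⟩ := IsExtriangulated.realize hV' hV (𝟙 W) f (by rw [push_id])
  exact h'.exists_pull_eq_of_push_eq hV (P.push φ η') (by
    rw [← push_comp, ← hφ, push_comp, hη', hf])

section CoendEval

variable {Z W Y B : C}

variable (P W) in
open Classical in
/-- Evaluation of formal sums of elementary tensors `g ⊗ δ ∈ 𝔼(X, W) ⊗ 𝔼(Z, X)` at
`η ∈ 𝔼(Z, Y)`, modulo the image of `𝔼(B, W)` under `x : Y ⟶ B`: a tensor with `δ = f_* η` goes to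
`f^* g`, and a tensor whose `δ` is not of this form goes to zero. -/
noncomputable def coendEval (η : P.Ext Z Y) (x : Y ⟶ B) :
    FreeAbelianGroup (P.CoendGen (P.higherExt W 1) Z) →+
      P.Ext Y W ⧸ (P.pull (A := W) x).range :=
  FreeAbelianGroup.lift fun t =>
    if hf : ∃ f : Y ⟶ t.1, P.push f η = t.2.2 then
      QuotientAddGroup.mk (P.pull hf.choose (ULift.down t.2.1 : P.Ext t.1 W))
    else 0

lemma coendEval_of {x : Y ⟶ B} {y : B ⟶ Z} {η : P.Ext Z Y} (h : P.IsTriangle x y η)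
    {X : C} (g : (P.higherExt W 1).obj (op X)) (δ : P.Ext Z X) (f : Y ⟶ X)
    (hf : P.push f η = δ) :
    coendEval P W η x (.of ⟨X, g, δ⟩) =
      QuotientAddGroup.mk (P.pull f (ULift.down g : P.Ext X W)) := by
  have hf' : ∃ f : Y ⟶ X, P.push f η = δ := ⟨f, hf⟩
  rw [coendEval, FreeAbelianGroup.lift_apply_of, dif_pos hf', eq_comm, QuotientAddGroup.eq]
  -- two maps that send `η` to `δ` differ by a map that factors through `x`
  obtain ⟨k, hk⟩ := h.exists_desc (hf'.choose - f) (by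
    rw [push_sub, hf'.choose_spec, hf, sub_self])
  refine ⟨P.pull k (ULift.down g : P.Ext X W), ?_⟩
  rw [← pull_comp, hk, pull_sub, sub_eq_neg_add]

/-- A relation of the coend evaluates to zero at every sufficiently fine `η ∈ 𝔼(Z, Y)`. -/
lemma exists_coendEval_eq_zero {t : FreeAbelianGroup (P.CoendGen (P.higherExt W 1) Z)}
    (ht : t ∈ AddSubgroup.closure {r | P.CoendRel (P.higherExt W 1) Z r}) :
    ∃ (Y₀ : C) (η₀ : P.Ext Z Y₀), ∀ (Y B : C) (η : P.Ext Z Y) (x : Y ⟶ B) (y : B ⟶ Z),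
      P.IsTriangle x y η → (∃ f : Y ⟶ Y₀, P.push f η = η₀) → coendEval P W η x t = 0 := by
  induction ht using AddSubgroup.closure_induction with
  | mem r hr =>
    obtain ⟨g, g', δ⟩ | ⟨g, δ, δ'⟩ | ⟨f, g, δ⟩ := hr
    · refine ⟨_, δ, ?_⟩
      rintro Y B η x y h ⟨f, hf⟩
      simp only [map_sub, coendEval_of h _ _ f hf]
      rw [show (ULift.down (g + g') : P.Ext _ W) = ULift.down g + ULift.down g' from rfl, map_add,
        QuotientAddGroup.mk_add]
      abel
    · rename_i X
      refine ⟨X ⊞ X, P.push biprod.inl δ + P.push biprod.inr δ', ?_⟩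
      rintro Y B η x y h ⟨f, hf⟩
      have h₁ : P.push (f ≫ biprod.fst) η = δ := by
        rw [push_comp, hf, push_fst_pair]
      have h₂ : P.push (f ≫ biprod.snd) η = δ' := by
        rw [push_comp, hf, push_snd_pair]
      simp only [map_sub]
      rw [coendEval_of h _ _ _ h₁, coendEval_of h _ _ _ h₂,
        coendEval_of h _ _ (f ≫ biprod.fst + f ≫ biprod.snd) (by rw [push_add, h₁, h₂]),
        pull_add, QuotientAddGroup.mk_add]
      abel
    · refine ⟨_, δ, ?_⟩
      rintro Y B η x y h ⟨k, hk⟩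
      rw [map_sub, coendEval_of h _ _ k hk, coendEval_of h _ _ (k ≫ f) (by rw [push_comp, hk]),
        pull_comp]
      exact sub_self _
  | zero => exact ⟨Z, 0, fun _ _ _ _ _ _ _ => map_zero _⟩
  | add s t _ _ hs ht =>
    obtain ⟨Y₁, η₁, h₁⟩ := hs
    obtain ⟨Y₂, η₂, h₂⟩ := ht
    refine ⟨Y₁ ⊞ Y₂, P.push biprod.inl η₁ + P.push biprod.inr η₂, ?_⟩
    rintro Y B η x y h ⟨f, hf⟩
    rw [map_add, h₁ Y B η x y h ⟨f ≫ biprod.fst, by rw [push_comp, hf, push_fst_pair]⟩,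
      h₂ Y B η x y h ⟨f ≫ biprod.snd, by rw [push_comp, hf, push_snd_pair]⟩, add_zero]
  | neg t _ ht =>
    obtain ⟨Y₀, η₀, h₀⟩ := ht
    exact ⟨Y₀, η₀, fun Y B η x y h hf => by rw [map_neg, h₀ Y B η x y h hf, neg_zero]⟩

/-- Exactness of `𝔼(B, W) ⟶ 𝔼(A, W) ⟶ 𝔼²(Z, W)` in the case `𝔼²(Z, W) = 0`. -/
lemma IsTriangle.exists_pull_eq_of_extN_two {A B Z W : C} {x : A ⟶ B} {y : B ⟶ Z} {δ : P.Ext Z A}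
    (h : P.IsTriangle x y δ) (h₂ : ∀ θ : P.ExtN 2 Z W, θ = 0) (ε : P.Ext A W) :
    ∃ ζ : P.Ext B W, P.pull x ζ = ε := by
  let g : (P.higherExt W 1).obj (op A) := ULift.up ε
  have h0 : (QuotientAddGroup.mk (FreeAbelianGroup.of ⟨A, g, δ⟩) :
    P.Coend (P.higherExt W 1) Z) = 0 := h₂ _
  obtain ⟨Y₀, η₀, hη₀⟩ := exists_coendEval_eq_zero ((QuotientAddGroup.eq_zero_iff _).1 h0)
  -- a common refinement of `η₀` and `δ`
  let η : P.Ext Z (Y₀ ⊞ A) := P.push biprod.inl η₀ + P.push biprod.inr δ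
  have e₁ : P.push biprod.fst η = η₀ := P.push_fst_pair η₀ δ
  have e₂ : P.push biprod.snd η = δ := P.push_snd_pair η₀ δ
  obtain ⟨D, k, l, hη⟩ := exists_isTriangle η
  have hev := hη₀ _ D η k l hη ⟨_, e₁⟩
  rw [coendEval_of hη g δ biprod.snd e₂, QuotientAddGroup.eq_zero_iff] at hev
  obtain ⟨ζ, hζ⟩ := hev
  exact hη.exists_pull_eq_of_push h biprod.snd e₂ ε ζ hζ

end CoendEval

/-! ### Hereditary cotorsion pairs -/

section Cotorsion

variable {T F : ObjectProperty C}

lemma closedUnderSummands_of_iso [HasZeroObject C] (hT : ClosedUnderSummands T) {X Y : C}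
    (e : X ≅ Y) (hX : T X) : T Y := by
  open ZeroObject in
  exact hT Y 0 X hX ⟨e ≪≫ (isoBiprodZero (isZero_zero C))⟩

namespace IsCotorsionPair

variable (hTF : P.IsCotorsionPair T F)
include hTF

lemma left_of_ext_eq_zero {X : C} (hX : ∀ Y, F Y → ∀ δ : P.Ext X Y, δ = 0) : T X := by
  obtain ⟨A, B, hA, hB, x, y, δ, h⟩ := hTF.exists_left X
  rw [hX A hA δ] at h
  obtain ⟨e⟩ := h.nonempty_iso
  exact hTF.summands_left X A B hB ⟨e ≪≫ biprod.braiding _ _⟩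

lemma right_of_ext_eq_zero {Y : C} (hY : ∀ X, T X → ∀ δ : P.Ext X Y, δ = 0) : F Y := by
  obtain ⟨A, B, hA, hB, x, y, δ, h⟩ := hTF.exists_right Y
  rw [hY B hB δ] at h
  exact hTF.summands_right Y B A hA h.nonempty_iso

lemma ext_left {A B Z : C} (hc : P.Conflation A B Z) (hA : T A) (hZ : T Z) : T B := by
  obtain ⟨x, y, δ, h⟩ := hc
  refine hTF.left_of_ext_eq_zero fun Y hY β => ?_
  obtain ⟨θ, rfl⟩ := h.exists_pull_eq β (hTF.ext_eq_zero _ _ hA hY _)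
  rw [hTF.ext_eq_zero _ _ hZ hY θ, map_zero]

lemma ext_right {A B Z : C} (hc : P.Conflation A B Z) (hA : F A) (hZ : F Z) : F B := by
  obtain ⟨x, y, δ, h⟩ := hc
  refine hTF.right_of_ext_eq_zero fun X hX β => ?_
  obtain ⟨θ, rfl⟩ := h.exists_push_eq β (hTF.ext_eq_zero _ _ hX hZ _)
  rw [hTF.ext_eq_zero _ _ hX hA θ, map_zero]

lemma cocone (hered : P.IsHereditary T F) {A B Z : C} (hc : P.Conflation A B Z) (hB : T B)
    (hZ : T Z) : T A := by
  obtain ⟨x, y, δ, h⟩ := hc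
  refine hTF.left_of_ext_eq_zero fun Y hY ε => ?_
  obtain ⟨ζ, rfl⟩ := h.exists_pull_eq_of_extN_two (hered 2 le_rfl Z Y hZ hY) ε
  rw [hTF.ext_eq_zero _ _ hB hY ζ, map_zero]

/-- Given `ε ∈ 𝔼(X, Z)` with `X` in `T`, an approximation of the middle term of `ε` shows that `ε` is
the image of an extension of `X` by some `N` in `T` under a map `N ⟶ Z`. This map lifts to `B`, and
`𝔼(X, B) = 0`. -/
lemma cone (hered : P.IsHereditary T F) {A B Z : C} (hc : P.Conflation A B Z) (hA : F A)
    (hB : F B) : F Z := by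
  obtain ⟨x, y, δ, h⟩ := hc
  refine hTF.right_of_ext_eq_zero fun X hX ε => ?_
  obtain ⟨U, g, g', hU⟩ := exists_isTriangle ε
  obtain ⟨F₁, T₁, -, hT₁, i, p, κ, hκ⟩ := hTF.exists_left U
  obtain ⟨N, h', d, e, δ'', hN, -, -, -, he, -⟩ := IsExtriangulated.et4_op hκ hU
  have hTN : T N := hTF.cocone hered ⟨_, _, _, hN⟩ hT₁ hX
  obtain ⟨k, rfl⟩ := h.exists_lift e (hTF.ext_eq_zero _ _ hTN hA _)
  rw [← he, push_comp, hTF.ext_eq_zero _ _ hX hB (P.push k δ''), map_zero]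

lemma hereditaryPair [HasZeroObject C] (hered : P.IsHereditary T F) :
    HereditaryPair P.Conflation T F where
  et4 := by
    rintro A B D Z W ⟨f, f', δ, h⟩ ⟨g, g', δ', h'⟩
    obtain ⟨X, _, _, _, _, h₁, -, -, h₂, -⟩ := IsExtriangulated.et4 h h'
    exact ⟨X, ⟨_, _, _, h₁⟩, ⟨_, _, _, h₂⟩⟩
  et4_op := by
    rintro A B D Z W ⟨f, f', δ, h⟩ ⟨g, g', δ', h'⟩
    obtain ⟨X, _, _, _, _, h₁, -, -, h₂, -⟩ := IsExtriangulated.et4_op h h'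
    exact ⟨X, ⟨_, _, _, h₁⟩, ⟨_, _, _, h₂⟩⟩
  pushout h h' := h.exists_pushout h'
  pullback h h' := h.exists_pullback h'
  ext_left := hTF.ext_left
  ext_right := hTF.ext_right
  cocone := hTF.cocone hered
  cone := hTF.cone hered
  exists_left := hTF.exists_left
  exists_right := hTF.exists_right

end IsCotorsionPair

end Cotorsion

end ExtData

/-! ### Grothendieck groups -/

section Grothendieck

open ExtData

variable {C : Type u} [Category.{v} C] [Preadditive C] [HasBinaryBiproducts C]

/-- The homomorphism out of the split Grothendieck group given by an additive function. -/
def K0sp.lift {G : Type*} [AddCommGroup G] (T : ObjectProperty C) (f : ∀ X, T X → G)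
    (hiso : ∀ X Y (hX : T X) (hY : T Y), (X ≅ Y) → f X hX = f Y hY)
    (hadd : ∀ A B (hA : T A) (hB : T B) (hAB : T (A ⊞ B)), f (A ⊞ B) hAB = f A hA + f B hB) :
    K0sp T →+ G :=
  QuotientAddGroup.lift _
    (FreeAbelianGroup.lift (Quotient.lift (fun X : T.FullSubcategory => f X.obj X.property)
      (by rintro X Y ⟨e⟩; exact hiso _ _ _ _ (T.ι.mapIso e))))
    (by
      rw [AddSubgroup.closure_le]
      rintro _ ⟨A, B, hA, hB, hAB⟩
      simp [gen, hadd A B hA hB hAB])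

@[simp]
lemma K0sp.lift_cls {G : Type*} [AddCommGroup G] (T : ObjectProperty C) (f : ∀ X, T X → G)
    (hiso : ∀ X Y (hX : T X) (hY : T Y), (X ≅ Y) → f X hX = f Y hY)
    (hadd : ∀ A B (hA : T A) (hB : T B) (hAB : T (A ⊞ B)), f (A ⊞ B) hAB = f A hA + f B hB)
    (X : C) (hX : T X) : K0sp.lift T f hiso hadd (K0sp.cls T X hX) = f X hX :=
  FreeAbelianGroup.lift_apply_of _ _

lemma K0sp.hom_ext {G : Type*} [AddCommGroup G] {T : ObjectProperty C} {f g : K0sp T →+ G}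
    (h : ∀ X hX, f (K0sp.cls T X hX) = g (K0sp.cls T X hX)) : f = g := by
  ext ⟨X⟩
  exact h X.obj X.property

lemma K0sp.mem_of_cls_mem {T : ObjectProperty C} {H : AddSubgroup (K0sp T)}
    (h : ∀ X hX, K0sp.cls T X hX ∈ H) (a : K0sp T) : a ∈ H := by
  obtain ⟨a, rfl⟩ := QuotientAddGroup.mk_surjective a
  induction a using FreeAbelianGroup.induction_on with
  | zero => exact H.zero_mem
  | of x => exact Quotient.inductionOn x fun X => h X.obj X.property
  | neg x hx => exact H.neg_mem hx
  | add a b ha hb => exact H.add_mem ha hb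

lemma K0sp.cls_eq_of_iso (T : ObjectProperty C) {X Y : C} (hX : T X) (hY : T Y) (e : X ≅ Y) :
    K0sp.cls T X hX = K0sp.cls T Y hY := by
  have : (Quotient.mk (isIsomorphicSetoid T.FullSubcategory) ⟨X, hX⟩) =
      Quotient.mk (isIsomorphicSetoid T.FullSubcategory) ⟨Y, hY⟩ :=
    Quotient.sound ⟨T.isoMk e⟩
  rw [K0sp.cls, K0sp.cls, gen, gen, this]

lemma K0sp.cls_biprod (T : ObjectProperty C) {A B : C} (hA : T A) (hB : T B) (hAB : T (A ⊞ B)) :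
    K0sp.cls T (A ⊞ B) hAB = K0sp.cls T A hA + K0sp.cls T B hB := by
  rw [← sub_eq_zero, ← sub_sub]
  exact (QuotientAddGroup.eq_zero_iff _).2 (AddSubgroup.subset_closure ⟨A, B, hA, hB, hAB⟩)

variable (P : ExtData.{w} C)

lemma K0.cls_eq_add (T : ObjectProperty C) {A B Z : C} (hA : T A) (hB : T B) (hZ : T Z)
    (h : P.Conflation A B Z) : K0.cls P T B hB = K0.cls P T A hA + K0.cls P T Z hZ := by
  have : K0.cls P T A hA - K0.cls P T B hB + K0.cls P T Z hZ = 0 :=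
    (QuotientAddGroup.eq_zero_iff _).2 (AddSubgroup.subset_closure ⟨A, B, Z, hA, hB, hZ, h⟩)
  rw [← sub_eq_zero, ← neg_eq_zero, ← this]
  abel

lemma K0.cls_eq_of_iso (T : ObjectProperty C) {X Y : C} (hX : T X) (hY : T Y) (e : X ≅ Y) :
    K0.cls P T X hX = K0.cls P T Y hY :=
  congrArg _ (K0sp.cls_eq_of_iso T hX hY e)

lemma K0.cls_biprod (T : ObjectProperty C) {A B : C} (hA : T A) (hB : T B) (hAB : T (A ⊞ B)) :
    K0.cls P T (A ⊞ B) hAB = K0.cls P T A hA + K0.cls P T B hB :=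
  congrArg _ (K0sp.cls_biprod T hA hB hAB)

/-- The homomorphism out of the Grothendieck group given by a function that is additive on
conflations. -/
def K0.lift {G : Type*} [AddCommGroup G] (T : ObjectProperty C) (f : K0sp T →+ G)
    (hadd : ∀ A B Z (hA : T A) (hB : T B) (hZ : T Z), P.Conflation A B Z →
      f (K0sp.cls T B hB) = f (K0sp.cls T A hA) + f (K0sp.cls T Z hZ)) : K0 P T →+ G :=
  QuotientAddGroup.lift _ f (by
    rw [AddSubgroup.closure_le]
    rintro _ ⟨A, B, Z, hA, hB, hZ, h⟩
    simp [hadd A B Z hA hB hZ h])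

lemma K0.lift_cls {G : Type*} [AddCommGroup G] (T : ObjectProperty C) (f : K0sp T →+ G)
    (hadd : ∀ A B Z (hA : T A) (hB : T B) (hZ : T Z), P.Conflation A B Z →
      f (K0sp.cls T B hB) = f (K0sp.cls T A hA) + f (K0sp.cls T Z hZ)) (X : C) (hX : T X) :
    K0.lift P T f hadd (K0.cls P T X hX) = f (K0sp.cls T X hX) := rfl

lemma K0.surjective_of_cls_mem {G : Type*} [AddCommGroup G] (T : ObjectProperty C) (f : G →+ K0 P T)
    (h : ∀ X hX, K0.cls P T X hX ∈ f.range) : Function.Surjective f := by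
  intro a
  obtain ⟨b, rfl⟩ := QuotientAddGroup.mk_surjective a
  exact K0sp.mem_of_cls_mem (H := f.range.comap (QuotientAddGroup.mk' _)) h b

/-- The homomorphism of split Grothendieck groups to a Grothendieck group induced by an inclusion. -/
def K0sp.toK0 {S T : ObjectProperty C} (hST : S ≤ T) : K0sp S →+ K0 P T :=
  K0sp.lift S (fun X hX => K0.cls P T X (hST X hX))
    (fun _ _ _ _ e => K0.cls_eq_of_iso P T _ _ e) (fun _ _ _ _ _ => K0.cls_biprod P T _ _ _)

@[simp]
lemma K0sp.toK0_cls {S T : ObjectProperty C} (hST : S ≤ T) (X : C) (hX : S X) :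
    K0sp.toK0 P hST (K0sp.cls S X hX) = K0.cls P T X (hST X hX) :=
  K0sp.lift_cls ..

/-- The homomorphism of Grothendieck groups induced by an inclusion. -/
def K0.map {S T : ObjectProperty C} (hST : S ≤ T) : K0 P S →+ K0 P T :=
  K0.lift P S (K0sp.toK0 P hST) fun A B Z hA hB hZ h => by
    simpa using K0.cls_eq_add P T _ _ _ h

@[simp]
lemma K0.map_cls {S T : ObjectProperty C} (hST : S ≤ T) (X : C) (hX : S X) :
    K0.map P hST (K0.cls P S X hX) = K0.cls P T X (hST X hX) :=
  K0sp.toK0_cls ..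

variable {P} [P.IsExtriangulated] [HasZeroObject C] {T F : ObjectProperty C}

/-- A left inverse of the homomorphism `K₀ˢᵖ(T ∩ F) ⟶ K₀(C)`. -/
lemma exists_leftInverse_toK0 (hTF : P.IsCotorsionPair T F)
    (hered : P.IsHereditary T F) (bdd : P.IsBounded T F) :
    ∃ χ : K0 P (⊤ : ObjectProperty C) →+ K0sp (T ⊓ F),
      ∀ X hX, χ (K0.cls P ⊤ X trivial) = K0sp.cls (T ⊓ F) X hX := by
  classical
  have H := hTF.hereditaryPair hered
  let m : C → K0sp (T ⊓ F) := fun X => if hX : (T ⊓ F) X then K0sp.cls (T ⊓ F) X hX else 0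
  have hm {X} (hX : (T ⊓ F) X) : m X = K0sp.cls (T ⊓ F) X hX := dif_pos hX
  obtain ⟨χ, hχ₁, hχ₂⟩ := H.exists_additive
    (fun X => by
      obtain ⟨n, -, hn⟩ := (bdd.2 ▸ trivial : P.leftClosure F X)
      exact ⟨n, (leftFilt_iff_coresolved F n X).1 hn⟩)
    (fun X => by
      obtain ⟨n, -, hn⟩ := (bdd.1 ▸ trivial : P.rightClosure T X)
      exact ⟨n, (rightFilt_iff_coresolved T n X).1 hn⟩)
    m (by
      rintro A B Z ⟨x, y, δ, h⟩ hTA hFA hTB hFB hTZ hFZ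
      -- conflations in `T ∩ F` split
      rw [hTF.ext_eq_zero Z A hTZ hFA δ] at h
      obtain ⟨e⟩ := h.nonempty_iso
      have hT := closedUnderSummands_of_iso hTF.summands_left e hTB
      have hF := closedUnderSummands_of_iso hTF.summands_right e hFB
      rw [hm ⟨hTA, hFA⟩, hm ⟨hTB, hFB⟩, hm ⟨hTZ, hFZ⟩,
        K0sp.cls_eq_of_iso _ _ (show (T ⊓ F) (A ⊞ Z) from ⟨hT, hF⟩) e, K0sp.cls_biprod])
  have hiso {X Y : C} (e : X ≅ Y) : χ X = χ Y := by
    open ZeroObject in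
    have h₁ := hχ₂ _ _ _ (conflation_of_iso (P := P) e (isZero_zero C))
    have h₂ := hχ₂ _ _ _ (conflation_of_iso (P := P) (Iso.refl X) (isZero_zero C))
    rw [left_eq_add] at h₂
    rw [h₁, h₂, add_zero]
  refine ⟨K0.lift P ⊤ (K0sp.lift ⊤ (fun X _ => χ X) (fun _ _ _ _ e => hiso e)
    (fun A B _ _ _ => hχ₂ _ _ _ (conflation_biprod A B))) (fun A B Z _ _ _ h => ?_),
    fun X hX => ?_⟩
  · simpa using hχ₂ _ _ _ h
  · rw [K0.lift_cls, K0sp.lift_cls, hχ₁ X hX.1 hX.2, hm hX]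

lemma toK0_left_surjective (hTF : P.IsCotorsionPair T F)
    (hered : P.IsHereditary T F) (bdd : P.IsBounded T F) :
    Function.Surjective (K0sp.toK0 P (inf_le_left : T ⊓ F ≤ T)) := by
  refine K0.surjective_of_cls_mem P T _ fun X hX => ?_
  refine (hTF.hereditaryPair hered).induction_left (fun X => by
      obtain ⟨n, -, hn⟩ := (bdd.2 ▸ trivial : P.leftClosure F X)
      exact ⟨n, (leftFilt_iff_coresolved F n X).1 hn⟩)
    (Q := fun X => ∀ hX, K0.cls P T X hX ∈ (K0sp.toK0 P (inf_le_left : T ⊓ F ≤ T)).range)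
    ?_ ?_ hX hX
  · intro X hT hF _
    exact ⟨K0sp.cls _ X ⟨hT, hF⟩, K0sp.toK0_cls ..⟩
  · intro X Y K hc _ hY hFY hK ih hX
    rw [eq_sub_of_add_eq (K0.cls_eq_add P T hX hY hK hc).symm]
    exact sub_mem ⟨K0sp.cls _ Y ⟨hY, hFY⟩, K0sp.toK0_cls ..⟩ (ih hK)

lemma toK0_right_surjective (hTF : P.IsCotorsionPair T F)
    (hered : P.IsHereditary T F) (bdd : P.IsBounded T F) :
    Function.Surjective (K0sp.toK0 P (inf_le_right : T ⊓ F ≤ F)) := by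
  refine K0.surjective_of_cls_mem P F _ fun X hX => ?_
  refine (hTF.hereditaryPair hered).dual.induction_left (fun X => by
      obtain ⟨n, -, hn⟩ := (bdd.1 ▸ trivial : P.rightClosure T X)
      exact ⟨n, (rightFilt_iff_coresolved T n X).1 hn⟩)
    (Q := fun X => ∀ hX, K0.cls P F X hX ∈ (K0sp.toK0 P (inf_le_right : T ⊓ F ≤ F)).range)
    ?_ ?_ hX hX
  · intro X hF hT _
    exact ⟨K0sp.cls _ X ⟨hT, hF⟩, K0sp.toK0_cls ..⟩
  · intro X Y K hc _ hY hTY hK ih hX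
    rw [eq_sub_of_add_eq' (K0.cls_eq_add P F hK hY hX hc).symm]
    exact sub_mem ⟨K0sp.cls _ Y ⟨hTY, hY⟩, K0sp.toK0_cls ..⟩ (ih hK)

lemma toK0_surjective (hTF : P.IsCotorsionPair T F)
    (hered : P.IsHereditary T F) (bdd : P.IsBounded T F) :
    Function.Surjective (K0sp.toK0 P (le_top : T ⊓ F ≤ ⊤)) := by
  have hT : (K0.map P (le_top : T ≤ ⊤)).comp (K0sp.toK0 P (inf_le_left : T ⊓ F ≤ T)) =
      K0sp.toK0 P le_top := K0sp.hom_ext fun X hX => by simp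
  have hF : (K0.map P (le_top : F ≤ ⊤)).comp (K0sp.toK0 P (inf_le_right : T ⊓ F ≤ F)) =
      K0sp.toK0 P le_top := K0sp.hom_ext fun X hX => by simp
  refine K0.surjective_of_cls_mem P ⊤ _ fun X _ => ?_
  obtain ⟨A, B, hA, hB, hc⟩ := hTF.exists_left X
  obtain ⟨a, ha⟩ := toK0_right_surjective hTF hered bdd (K0.cls P F A hA)
  obtain ⟨b, hb⟩ := toK0_left_surjective hTF hered bdd (K0.cls P T B hB)
  refine ⟨b - a, ?_⟩
  have e₁ := DFunLike.congr_fun hF a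
  have e₂ := DFunLike.congr_fun hT b
  rw [AddMonoidHom.comp_apply, ha, K0.map_cls] at e₁
  rw [AddMonoidHom.comp_apply, hb, K0.map_cls] at e₂
  rw [map_sub, ← e₁, ← e₂, sub_eq_iff_eq_add']
  exact K0.cls_eq_add P ⊤ trivial trivial trivial hc

end Grothendieck

end Extri

open Extri in
theorem corollary4p7 {C : Type u} [Category.{v} C] [Preadditive C]
    [HasZeroObject C] [HasBinaryBiproducts C] (P : Extri.ExtData.{w} C) [P.IsExtriangulated]
    (T F : ObjectProperty C) (hTF : P.IsCotorsionPair T F)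
    (hered : P.IsHereditary T F) (bdd : P.IsBounded T F) :
    ∃ (e₁ : Extri.K0 P T ≃+ Extri.K0 P F) (e₂ : Extri.K0 P F ≃+ Extri.K0 P (⊤ : ObjectProperty C))
      (e₃ : Extri.K0 P (⊤ : ObjectProperty C) ≃+ Extri.K0sp (T ⊓ F)),
      (∀ (X : C) (hX : T X),
        e₂ (e₁ (Extri.K0.cls P T X hX)) = Extri.K0.cls P ⊤ X trivial) ∧
      (∀ (X : C) (hX : F X), e₂ (Extri.K0.cls P F X hX) = Extri.K0.cls P ⊤ X trivial) ∧
      (∀ (X : C) (hX : (T ⊓ F) X),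
        e₃ (Extri.K0.cls P ⊤ X trivial) = Extri.K0sp.cls (T ⊓ F) X hX) := by
  obtain ⟨χ, hχ⟩ := exists_leftInverse_toK0 hTF hered bdd
  have hinj : Function.Injective (K0sp.toK0 P (le_top : T ⊓ F ≤ ⊤)) := by
    have h : χ.comp (K0sp.toK0 P (le_top : T ⊓ F ≤ ⊤)) = AddMonoidHom.id _ :=
      K0sp.hom_ext fun X hX => by simp [hχ X hX]
    exact Function.LeftInverse.injective (DFunLike.congr_fun h)
  have hbij : Function.Bijective (K0sp.toK0 P (le_top : T ⊓ F ≤ ⊤)) :=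
    ⟨hinj, toK0_surjective hTF hered bdd⟩
  -- an inclusion `T ∩ F ⊆ S` that is onto on `K₀` makes `K₀(S) ⟶ K₀(C)` bijective
  have aux {S : ObjectProperty C} (hS : T ⊓ F ≤ S)
      (hsurj : Function.Surjective (K0sp.toK0 P hS)) :
      Function.Bijective (K0.map P (le_top : S ≤ ⊤)) := by
    have h : (K0.map P (le_top : S ≤ ⊤)).comp (K0sp.toK0 P hS) = K0sp.toK0 P le_top :=
      K0sp.hom_ext fun X hX => by simp
    have h' : ⇑(K0.map P (le_top : S ≤ ⊤)) ∘ K0sp.toK0 P hS = K0sp.toK0 P le_top :=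
      congrArg DFunLike.coe h
    rw [← h'] at hbij
    exact ⟨hbij.1.of_comp_right hsurj, hbij.2.of_comp⟩
  let eT := AddEquiv.ofBijective _ (aux inf_le_left (toK0_left_surjective hTF hered bdd))
  let eF := AddEquiv.ofBijective _ (aux inf_le_right (toK0_right_surjective hTF hered bdd))
  let e := AddEquiv.ofBijective _ hbij
  refine ⟨eT.trans eF.symm, eF, e.symm, fun X hX => ?_, fun X hX => K0.map_cls ..,
    fun X hX => ?_⟩
  · rw [AddEquiv.trans_apply, AddEquiv.apply_symm_apply]
    exact K0.map_cls ..
  · rw [AddEquiv.symm_apply_eq]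
    exact (K0sp.toK0_cls P le_top X hX).symm
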